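/- Consider a game with $N$ players. Player $i$ has a non-empty convex compact action set $A_i\subset\mathbb R^{d_i}$ and a cost $J_i:\mathbb R^{d_1}\times\dots\times\mathbb R^{d_N}\to\mathbb R$ that is continuously differentiable in the joint action $a=(a^1,\dots,a^N)$; there are no coupling constraints. Put $A=A_1\times\dots\times A_N$, and let $M=(M_1,\dots,M_N)$ with $M_i(a)=\nabla_{a^i}J_i(a)$ be the game mapping. Assume: (a) $M$ is strictly monotone on $A$: $(M(a)-M(b),a-b)>0$ for all $a\neq b$ in $A$; (b) each $M_i$ is Lipschitz on the whole space; (c) each $J_i$ grows at most quadratically in the player's own action: there are constants $K_i,Q_i$ and $m_i\in\mathbb N$ with $|J_i(a)|\le K_i\bigl(1+\sum_{j\ne i}\|a^j\|\bigr)^{m_i}\bigl(1+\|a^i\|^2\bigr)$ whenever $\|a^i\|\ge Q_i$. Let $\gamma_i(t)>0$ and $\sigma_i(t)>0$ for $i\in\{1,\dots,N\}$ and $t=0,1,2,\dots$, put $\beta_i(t)=\gamma_i(t)\sigma_i(t)^2$, and let the subscripts $\min$ and $\max$ denote the minimum and the maximum over $i$. Assume $$\sum_t\beta_{\min}(t)=\infty,\quad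 \sum_t\bigl(\beta_{\max}(t)-\beta_{\min}(t)\bigr)<\infty,\quad \sum_t\gamma_{\max}(t)^2\sigma_{\max}(t)^2<\infty,\quad \sum_t\gamma_{\max}(t)\sigma_{\max}(t)^3<\infty,$$ and, for every $i$, $\sigma_i(t)\to0$ as $t\to\infty$ and $\sup_t\sigma_i(t+1)/\sigma_i(t)<\infty$. Let the joint states $x(t)=(x^1(t),\dots,x^N(t))$ and the means $\mu(t)=(\mu^1(t),\dots,\mu^N(t))$ be generated as follows, from an arbitrary initial vector $\mu(0)$: conditionally on the past up to the determination of $\mu(t)$, the coordinates $x^i_k(t)$ are independent and normally distributed with mean $\mu^i_k(t)$ and variance $\sigma_i(t)^2$, and $$\mu^i(t+1)=\mathrm{Proj}_{A_i}\Bigl[\mu^i(t)-\gamma_i(t+1)\,\sigma_i(t+1)^2\,J_i(x(t))\,\frac{x^i(t)-\mu^i(t)}{\sigma_i(t)^2}\Bigr],\qquad i=1,\dots,N,$$ where $\mathrm{Proj}_{A_i}$ is the Euclidean projection on $A_i$. Then the game has exactly one Nash equilibrium $a^*$ (that is, $a^*\in A$ and $J_i(a^*)\le J_i(y,a^{*-i})$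 for all $i$ and all $y\in A_i$); as $t\to\infty$, $\mu(t)$ converges to $a^*$ almost surely, and $x(t)$ converges to $a^*$ in probability. -/

import Mathlib

open MeasureTheory ProbabilityTheory Filter Topology
open scoped NNReal ENNReal

noncomputable section

namespace PayoffLearning

variable {N : ℕ} {d : Fin N → ℕ}

/-- Joint actions `a = (a¹, …, aᴺ)`, player `i` acting in the Euclidean space `ℝ^(d i)`.
The product carries the product topology and the Borel σ-algebra; its Mathlib norm is
`max_i ‖aⁱ‖`, which is equivalent to the Euclidean norm of the concatenated vector. -/
abbrev Joint (d : Fin N → ℕ) : Type := (i : Fin N) → EuclideanSpace ℝ (Fin (d i))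

/-- The set `A = A₁ × … × A_N` of feasible joint actions (no coupling constraints). -/
def feasible (A : (i : Fin N) → Set (EuclideanSpace ℝ (Fin (d i)))) : Set (Joint d) :=
  {a | ∀ i, a i ∈ A i}

/-- Nash equilibrium: a feasible joint action from which no player can lower its own cost by
a unilateral feasible deviation. -/
def IsNash (A : (i : Fin N) → Set (EuclideanSpace ℝ (Fin (d i)))) (J : Fin N → Joint d → ℝ)
    (a : Joint d) : Prop :=
  a ∈ feasible A ∧ ∀ i, ∀ y ∈ A i, J i a ≤ J i (Function.update a i y)

/-- The game mapping: its `i`-th block is the partial gradient of `J i` with respect to the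
action of player `i`, with coordinates `∂ J i / ∂ aⁱ_k`. -/
def gameMap (J : Fin N → Joint d → ℝ) (a : Joint d) : Joint d :=
  fun i => gradient (fun y => J i (Function.update a i y)) (a i)

/-- Strict monotonicity over `S`, for the standard inner product of `ℝ^(d 1 + … + d N)`. -/
def StrictlyMonotoneOn (M : Joint d → Joint d) (S : Set (Joint d)) : Prop :=
  ∀ a ∈ S, ∀ b ∈ S, a ≠ b → 0 < ∑ i, inner ℝ (M a i - M b i) (a i - b i)

/-- The cost of player `i` grows at most quadratically in the player's own action: for
`‖aⁱ‖ ≥ Q` it is bounded by a quadratic function of `aⁱ`, whose coefficients may depend on the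
actions of the other players, at most polynomially. -/
def GrowsQuadratically (J : Fin N → Joint d → ℝ) (i : Fin N) : Prop :=
  ∃ (K Q : ℝ) (m : ℕ), ∀ a : Joint d, Q ≤ ‖a i‖ →
    |J i a| ≤ K * (1 + ∑ j ∈ Finset.univ.erase i, ‖a j‖) ^ m * (1 + ‖a i‖ ^ 2)

/-- `v` is the Euclidean projection of `u` on the set `S`: a nearest point of `S`. -/
def IsProj {E : Type*} [NormedAddCommGroup E] (S : Set E) (u v : E) : Prop :=
  v ∈ S ∧ ∀ w ∈ S, ‖u - v‖ ≤ ‖u - w‖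

/-- The normal distribution of the joint state: all coordinates `xⁱ_k` are independent, with
`xⁱ_k` normal of mean `mⁱ_k` and standard deviation `s i`. -/
def normalLaw (m : Joint d) (s : Fin N → ℝ) : Measure (Joint d) :=
  Measure.pi fun i =>
    (Measure.pi fun k : Fin (d i) => gaussianReal (m i k) (Real.toNNReal (s i ^ 2))).map
      (WithLp.toLp 2)

/-- `β i t = γ i t * (σ i t) ^ 2`. -/
def beta (γ σ : Fin N → ℕ → ℝ) (i : Fin N) (t : ℕ) : ℝ := γ i t * σ i t ^ 2

/-- The conditions on the step sizes `γ i t` and the standard deviations `σ i t`. -/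
structure StepSizes (γ σ : Fin N → ℕ → ℝ) : Prop where
  step_pos : ∀ i t, 0 < γ i t
  sd_pos : ∀ i t, 0 < σ i t
  sum_min : Tendsto (fun n => ∑ t ∈ Finset.range n, ⨅ i, beta γ σ i t) atTop atTop
  sum_diff : Summable fun t => (⨆ i, beta γ σ i t) - ⨅ i, beta γ σ i t
  sum_sq : Summable fun t => (⨆ i, γ i t) ^ 2 * (⨆ i, σ i t) ^ 2
  sum_cube : Summable fun t => (⨆ i, γ i t) * (⨆ i, σ i t) ^ 3

/-- A run of the payoff-based algorithm with means `μ t` and states `x t`. The initial mean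
`μ 0` is arbitrary (any vector, or any `ℱ 0`-measurable random vector). -/
structure IsRun {Ω : Type*} {mΩ : MeasurableSpace Ω} (P : Measure Ω) (ℱ : Filtration ℕ mΩ)
    (A : (i : Fin N) → Set (EuclideanSpace ℝ (Fin (d i)))) (J : Fin N → Joint d → ℝ)
    (γ σ : Fin N → ℕ → ℝ) (μ x : ℕ → Ω → Joint d) : Prop where
  /-- The mean at time `t` is determined by the past `ℱ t`. -/
  mean_meas : ∀ t, Measurable[ℱ t] (μ t)
  /-- The state sampled at time `t` belongs to the past of time `t + 1`. -/
  state_meas : ∀ t, Measurable[ℱ (t + 1)] (x t)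
  /-- Conditionally on the past `ℱ t`, the state `x t` has the normal distribution with mean
  `μ t` and standard deviations `σ · t`. -/
  state_law : ∀ t, ∀ S : Set Ω, MeasurableSet[ℱ t] S → ∀ B : Set (Joint d), MeasurableSet B →
    P (S ∩ x t ⁻¹' B) = ∫⁻ ω in S, normalLaw (μ t ω) (fun i => σ i t) B ∂P
  /-- The projected payoff-based update of the means. -/
  update : ∀ t ω i,
    IsProj (A i)
      (μ t ω i - (γ i (t + 1) * σ i (t + 1) ^ 2) •
        (J i (x t ω) • ((1 / σ i t ^ 2) • (x t ω i - μ t ω i))))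
      (μ (t + 1) ω i)

end PayoffLearning

end

open PayoffLearning

noncomputable section

namespace PayoffLearning

variable {N : ℕ} {d : Fin N → ℕ}

/-! Equilibria are identified with solutions of the variational inequality of `gameMap`. A solution
exists by `exists_variational_of_mono`. Adding the inequality at a solution `a` to strict
monotonicity gives `IsVariational.inner_pos`: at every other feasible `b`, the field paired with `b
- a` is positive. This yields uniqueness and, through the mean value theorem, the equilibrium
property; no separate convexity of the costs is needed.

For the dynamics, write `x = μ + σ z` blockwise. Then `z` is standard normal and independent of the
past, and the update of player `i` moves by `-(β i (t+1) / σ i t) J i (x) z i` before projecting.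
Gaussian symmetry under `z i ↦ -z i` and the Lipschitz gradient show that the mean of `J i (x) z i`
is `σ i t` times the partial gradient at `μ`, up to a relative error of order `∑ j, σ j t`
(`abs_integral_score_sub_le`). The algorithm is thus a noisy projected gradient play with vanishing
bias.

Projections do not increase distances, so the squared distance `V` to `a` obeys a perturbed descent
inequality with step `⨅ j, β j`. Its perturbations have convergent series: unequal steps cost a
multiple of `⨆ β - ⨅ β`, the quadratic terms have summable expectations, and the centred noise is an
L²-bounded martingale (`IsRun.ae_tendsto_sum_centred`). By compactness the drift is bounded below
away from `a` (`IsVariational.exists_drift_bound`), so the deterministic lemma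
`tendsto_zero_of_perturbed_descent` gives `V → 0` on almost every path. The states follow because `x
- μ` is `σ` times a standard normal vector. -/

/-- A nonnegative sequence with drift `-b t * φ t` away from `0`, a vanishing relative bias `e`
and a convergent series of perturbations `n` tends to `0`. -/
theorem tendsto_zero_of_perturbed_descent {V b φ e n : ℕ → ℝ} {B l : ℝ}
    (hV : ∀ t, 0 ≤ V t) (hb : ∀ t, 0 ≤ b t) (hB : ∀ t, b t ≤ B)
    (hsum : Tendsto (fun k => ∑ t ∈ Finset.range k, b t) atTop atTop)
    (he : Tendsto e atTop (𝓝 0))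
    (hn : Tendsto (fun k => ∑ t ∈ Finset.range k, n t) atTop (𝓝 l))
    (hφ_nonneg : ∀ t, 0 ≤ φ t)
    (hφ : ∀ ε > 0, ∃ δ > 0, ∀ t, ε ≤ V t → δ ≤ φ t)
    (hstep : ∀ t, V (t + 1) ≤ V t - b t * (φ t - e t) + n t) :
    Tendsto V atTop (𝓝 0) := by
  have hB0 : 0 ≤ B := (hb 0).trans (hB 0)
  have key : ∀ ε > 0, ∃ T, ∀ t ≥ T, V t < 4 * ε := by
    intro ε hε
    obtain ⟨δ, hδ, hδφ⟩ := hφ ε hε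
    -- The tail of the noise series. Adding it to `V` absorbs `n`, so `U = V + r` satisfies the
    -- descent inequality without noise, and `r` is eventually below `ε`.
    set r : ℕ → ℝ := fun t => l - ∑ s ∈ Finset.range t, n s with hr
    have hr0 : Tendsto r atTop (𝓝 0) := by
      simpa using (tendsto_const_nhds (x := l)).sub hn
    -- The first bound on `e` leaves half of the drift `δ`; the second limits one upward step of `U`
    -- to `ε`.
    have hη : 0 < min (δ / 2) (ε / (B + 1)) := by positivity
    obtain ⟨T₁, hT₁⟩ := (Metric.tendsto_atTop.1 hr0) ε hε
    obtain ⟨T₂, hT₂⟩ := (Metric.tendsto_atTop.1 he) _ hη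
    set T := max T₁ T₂
    have hrT : ∀ t ≥ T, |r t| < ε := fun t ht => by
      simpa [Real.dist_eq] using hT₁ t (le_trans (le_max_left _ _) ht)
    have heT : ∀ t ≥ T, e t ≤ δ / 2 ∧ b t * e t ≤ ε := fun t ht => by
      have h := hT₂ t (le_trans (le_max_right _ _) ht)
      rw [Real.dist_eq, sub_zero] at h
      have h1 := (le_abs_self _).trans (h.le.trans (min_le_left _ _))
      have h2 := (le_abs_self _).trans (h.le.trans (min_le_right _ _))
      refine ⟨h1, ?_⟩
      calc b t * e t ≤ b t * (ε / (B + 1)) := mul_le_mul_of_nonneg_left h2 (hb t)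
        _ ≤ (B + 1) * (ε / (B + 1)) := by
            gcongr; linarith [hB t]
        _ = ε := by field_simp
    set U : ℕ → ℝ := fun t => V t + r t with hU
    have hUstep : ∀ t, U (t + 1) ≤ U t - b t * (φ t - e t) := fun t => by
      have := hstep t
      simp only [hU, hr, Finset.sum_range_succ]
      linarith
    have hdec : ∀ t ≥ T, 2 * ε ≤ U t → U (t + 1) ≤ U t - b t * (δ / 2) := by
      intro t ht hUt
      have h1 := abs_lt.1 (hrT t ht)
      have h2 : δ ≤ φ t := hδφ t (by simp only [hU] at hUt; linarith)
      have h3 := hUstep t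
      have h4 : b t * (δ / 2) ≤ b t * (φ t - e t) :=
        mul_le_mul_of_nonneg_left (by linarith [(heT t ht).1]) (hb t)
      linarith
    have hsmall : ∀ t ≥ T, U t < 2 * ε → U (t + 1) < 3 * ε := by
      intro t ht hUt
      have h3 := hUstep t
      have h4 := (heT t ht).2
      have h5 := mul_nonneg (hb t) (hφ_nonneg t)
      nlinarith
    -- Otherwise `U` would lose `δ / 2` times a divergent sum while staying above `2 * ε`.
    have hentry : ∃ t₀ ≥ T, U t₀ < 2 * ε := by
      by_contra! hcon
      have hlin : ∀ k, U (T + k) ≤ U T - (δ / 2) *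
          (∑ t ∈ Finset.range (T + k), b t - ∑ t ∈ Finset.range T, b t) := by
        intro k
        induction k with
        | zero => simp
        | succ k ih =>
          have h := hdec (T + k) (by omega) (hcon _ (by omega))
          rw [← add_assoc, Finset.sum_range_succ]
          linarith
      obtain ⟨k, hk⟩ := (((tendsto_add_atTop_iff_nat T).2 hsum).eventually_gt_atTop
        (∑ t ∈ Finset.range T, b t + U T / (δ / 2))).exists
      have h1 := hlin k
      have h2 := hcon (T + k) (by omega)
      rw [add_comm k T] at hk
      have h3 : U T < (δ / 2) *
          (∑ t ∈ Finset.range (T + k), b t - ∑ t ∈ Finset.range T, b t) := by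
        rw [mul_comm, ← div_lt_iff₀ (by positivity)]
        linarith
      linarith
    obtain ⟨t₀, ht₀, hUt₀⟩ := hentry
    refine ⟨t₀, fun t ht => ?_⟩
    -- The level `3 * ε` is never crossed again: from below `2 * ε` a step gains at most `ε`, and
    -- from above `2 * ε` it does not increase `U`.
    have hinv : U t < 3 * ε := by
      induction t, ht using Nat.le_induction with
      | base => linarith
      | succ t ht ih =>
        rcases lt_or_ge (U t) (2 * ε) with h | h
        · exact hsmall t (ht₀.trans ht) h
        · have h1 := hdec t (ht₀.trans ht) h
          have := mul_nonneg (hb t) hδ.le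
          linarith
    have := abs_lt.1 (hrT t (ht₀.trans ht))
    simp only [hU] at hinv
    linarith
  refine Metric.tendsto_atTop.2 fun ε hε => ?_
  obtain ⟨T, hT⟩ := key (ε / 4) (by positivity)
  refine ⟨T, fun t ht => ?_⟩
  rw [Real.dist_eq, sub_zero, abs_of_nonneg (hV t)]
  linarith [hT t ht]

/-! ### Projections and variational inequalities on compact convex sets -/

section Projection

theorem isProj_self {E : Type*} [NormedAddCommGroup E] {S : Set E} {v : E} (hv : v ∈ S) : IsProj S v v :=
  ⟨hv, fun w _ => by simp⟩

theorem exists_isProj {E : Type*} [NormedAddCommGroup E] {S : Set E} (hne : S.Nonempty) (hS : IsCompact S) (u : E) :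
    ∃ v, IsProj S u v := by
  obtain ⟨v, hv, h⟩ := hS.exists_isMinOn hne
    (f := fun w => ‖u - w‖) (by fun_prop)
  exact ⟨v, hv, fun w hw => h hw⟩

variable {E : Type*} [NormedAddCommGroup E] [InnerProductSpace ℝ E]

theorem IsProj.inner_le_zero {S : Set E} (hS : Convex ℝ S) {u v : E} (h : IsProj S u v) :
    ∀ w ∈ S, inner ℝ (u - v) (w - v) ≤ 0 := by
  refine (norm_eq_iInf_iff_real_inner_le_zero hS h.1).1 (le_antisymm ?_ ?_)
  · have : Nonempty S := ⟨⟨v, h.1⟩⟩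
    exact le_ciInf fun w => h.2 w w.2
  · exact ciInf_le ⟨0, by rintro _ ⟨w, rfl⟩; exact norm_nonneg _⟩ (⟨v, h.1⟩ : S)

/-- Summing the two obtuse-angle inequalities bounds `‖v - v'‖ ^ 2` by the inner product of `u - u'`
and `v - v'`; Cauchy–Schwarz concludes. -/
theorem IsProj.norm_sub_le {S : Set E} (hS : Convex ℝ S) {u u' v v' : E} (h : IsProj S u v)
    (h' : IsProj S u' v') : ‖v - v'‖ ≤ ‖u - u'‖ := by
  have h1 := h.inner_le_zero hS v' h'.1
  have h2 := h'.inner_le_zero hS v h.1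
  have h3 : ‖v - v'‖ ^ 2 ≤ inner ℝ (u - u') (v - v') := by
    rw [← real_inner_self_eq_norm_sq]
    have e1 : inner ℝ (u - v) (v' - v) = - inner ℝ (u - v) (v - v') := by
      rw [← inner_neg_right, neg_sub]
    have e2 : inner ℝ (u - u') (v - v') - inner ℝ (v - v') (v - v') =
        inner ℝ (u - v) (v - v') - inner ℝ (u' - v') (v - v') := by
      rw [← inner_sub_left, ← inner_sub_left]; congr 1; abel
    linarith
  have h4 := real_inner_le_norm (u - u') (v - v')
  rcases (norm_nonneg (v - v')).eq_or_lt with h0 | h0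
  · rw [← h0]; exact norm_nonneg _
  · nlinarith

/-- Fixed points of `a ↦ p (a - τ • F a)` solve the inequality. For small `τ` this map strictly
shortens distances on `S`, so a minimiser of the displacement over the compact set `S` must be
fixed. -/
theorem exists_variational_of_strongMono {S : Set E} (hne : S.Nonempty) (hcv : Convex ℝ S)
    (hS : IsCompact S) {F : E → E} {L : ℝ≥0} (hF : LipschitzWith L F) {ε : ℝ} (hε : 0 < ε)
    (hmono : ∀ a ∈ S, ∀ b ∈ S, ε * ‖a - b‖ ^ 2 ≤ inner ℝ (F a - F b) (a - b)) :
    ∃ a ∈ S, ∀ b ∈ S, 0 ≤ inner ℝ (F a) (b - a) := by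
  choose p hp using exists_isProj hne hS
  -- With this `τ` the quadratic term in `τ` uses at most half of the gain `2 * τ * ε * ‖a - b‖ ^ 2`
  -- from strong monotonicity.
  set τ : ℝ := ε / (L + 1) ^ 2 with hτ
  have hτ0 : 0 < τ := by positivity
  set T : E → E := fun a => p (a - τ • F a) with hT
  have hpc : Continuous p :=
    (LipschitzWith.of_dist_le_mul (K := 1) fun u v => by
      simpa [dist_eq_norm] using (hp u).norm_sub_le hcv (hp v)).continuous
  have hFc := hF.continuous
  have hTc : Continuous T := hpc.comp (by fun_prop)
  have hcontr : ∀ a ∈ S, ∀ b ∈ S, a ≠ b → ‖T a - T b‖ < ‖a - b‖ := by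
    intro a ha b hb hab
    have h0 : 0 < ‖a - b‖ := norm_pos_iff.2 (sub_ne_zero.2 hab)
    have h1 := (hp (a - τ • F a)).norm_sub_le hcv (hp (b - τ • F b))
    refine h1.trans_lt ?_
    have h2 : a - τ • F a - (b - τ • F b) = (a - b) - τ • (F a - F b) := by
      rw [smul_sub]; abel
    rw [h2]
    refine lt_of_pow_lt_pow_left₀ 2 (norm_nonneg _) ?_
    rw [norm_sub_sq_real, inner_smul_right, norm_smul, mul_pow, Real.norm_of_nonneg hτ0.le,
      real_inner_comm]
    have h3 := hmono a ha b hb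
    have h4 : ‖F a - F b‖ ≤ L * ‖a - b‖ := by simpa [dist_eq_norm] using hF.dist_le_mul a b
    have h5 : ‖F a - F b‖ ^ 2 ≤ (L + 1) ^ 2 * ‖a - b‖ ^ 2 := by
      rw [← mul_pow]
      exact pow_le_pow_left₀ (norm_nonneg _) (h4.trans (by nlinarith)) 2
    have h6 : τ ^ 2 * ‖F a - F b‖ ^ 2 ≤ τ * (ε * ‖a - b‖ ^ 2) := by
      calc τ ^ 2 * ‖F a - F b‖ ^ 2 ≤ τ ^ 2 * ((L + 1) ^ 2 * ‖a - b‖ ^ 2) := by gcongr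
        _ = τ * (ε * ‖a - b‖ ^ 2) := by rw [hτ]; field_simp
    have h7 : τ * (ε * ‖a - b‖ ^ 2) ≤ τ * inner ℝ (F a - F b) (a - b) := by gcongr
    have h8 : 0 < τ * (ε * ‖a - b‖ ^ 2) := by positivity
    linarith
  obtain ⟨a, ha, hmin⟩ := hS.exists_isMinOn hne (f := fun a => ‖a - T a‖)
    (by fun_prop)
  have hTa : T a ∈ S := (hp _).1
  have hfix : a = T a := by
    by_contra hne'
    exact absurd (hcontr a ha _ hTa hne') (not_lt.2 (hmin hTa))
  refine ⟨a, ha, fun b hb => ?_⟩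
  have h := (hp (a - τ • F a)).inner_le_zero hcv b hb
  have h' : p (a - τ • F a) = a := hfix.symm
  rw [h', sub_sub_cancel_left, inner_neg_left, inner_smul_left] at h
  simp only [conj_trivial] at h
  by_contra! hneg
  nlinarith

/-- Solvability of the variational inequality of a monotone Lipschitz map on a compact convex
set. -/
theorem exists_variational_of_mono {S : Set E} (hne : S.Nonempty) (hcv : Convex ℝ S)
    (hS : IsCompact S) {F : E → E} {L : ℝ≥0} (hF : LipschitzWith L F)
    (hmono : ∀ a ∈ S, ∀ b ∈ S, 0 ≤ inner ℝ (F a - F b) (a - b)) :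
    ∃ a ∈ S, ∀ b ∈ S, 0 ≤ inner ℝ (F a) (b - a) := by
  -- Tikhonov regularisation: adding `a / (n + 1)` makes the map strongly monotone, and a limit
  -- point of the regularised solutions solves the original inequality.
  have hreg : ∀ n : ℕ, ∃ a ∈ S, ∀ b ∈ S,
      0 ≤ inner ℝ (F a + (1 / ((n : ℝ) + 1)) • a) (b - a) := by
    intro n
    have hε : (0 : ℝ) < 1 / ((n : ℝ) + 1) := Nat.one_div_pos_of_nat
    refine exists_variational_of_strongMono hne hcv hS
      (F := fun a => F a + (1 / ((n : ℝ) + 1)) • a)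
      (hF.add (lipschitzWith_smul (1 / ((n : ℝ) + 1)))) hε fun a ha b hb => ?_
    have h1 : F a + (1 / ((n : ℝ) + 1)) • a - (F b + (1 / ((n : ℝ) + 1)) • b) =
        (F a - F b) + (1 / ((n : ℝ) + 1)) • (a - b) := by rw [smul_sub]; abel
    rw [h1, inner_add_left, inner_smul_left, real_inner_self_eq_norm_sq]
    simpa using hmono a ha b hb
  choose u hu hvi using hreg
  obtain ⟨a, ha, ψ, hψ, hlim⟩ := hS.tendsto_subseq hu
  refine ⟨a, ha, fun b hb => ?_⟩
  have hε : Tendsto (fun n => 1 / (((ψ n : ℕ) : ℝ) + 1)) atTop (𝓝 0) :=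
    tendsto_one_div_add_atTop_nhds_zero_nat.comp hψ.tendsto_atTop
  have h1 : Tendsto (fun n => inner ℝ (F (u (ψ n)) + (1 / (((ψ n : ℕ) : ℝ) + 1)) • u (ψ n))
      (b - u (ψ n))) atTop (𝓝 (inner ℝ (F a + (0 : ℝ) • a) (b - a))) :=
    (((hF.continuous.tendsto a).comp hlim).add (hε.smul hlim)).inner
      (tendsto_const_nhds.sub hlim)
  rw [zero_smul, add_zero] at h1
  exact ge_of_tendsto' h1 fun n => hvi _ b hb

end Projection

/-! ### Nash equilibria as solutions of the variational inequality -/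

section Game

variable {A : (i : Fin N) → Set (EuclideanSpace ℝ (Fin (d i)))} {J : Fin N → Joint d → ℝ}

theorem isCompact_feasible (hA : ∀ i, IsCompact (A i)) : IsCompact (feasible A) := by
  have : feasible A = Set.univ.pi A := by ext a; simp [feasible]
  rw [this]
  exact isCompact_univ_pi hA

theorem update_mem_feasible {a : Joint d} (ha : a ∈ feasible A) {i : Fin N}
    {y : EuclideanSpace ℝ (Fin (d i))} (hy : y ∈ A i) : Function.update a i y ∈ feasible A := by
  intro j
  rcases eq_or_ne j i with rfl | h
  · simpa using hy
  · simpa [h] using ha j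

theorem exists_lipschitzWith_gameMap (h : ∀ i, ∃ L : ℝ≥0, LipschitzWith L fun a => gameMap J a i) :
    ∃ L : ℝ≥0, LipschitzWith L (gameMap J) := by
  choose L hL using h
  refine ⟨∑ i, L i, LipschitzWith.of_dist_le_mul fun a b => ?_⟩
  refine (dist_pi_le_iff (by positivity)).2 fun i => ((hL i).dist_le_mul a b).trans ?_
  gcongr
  exact_mod_cast Finset.single_le_sum (f := L) (fun _ _ => zero_le) (Finset.mem_univ i)

/-- A joint action solving the variational inequality of the game mapping. -/
def IsVariational (A : (i : Fin N) → Set (EuclideanSpace ℝ (Fin (d i))))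
    (J : Fin N → Joint d → ℝ) (a : Joint d) : Prop :=
  a ∈ feasible A ∧ ∀ b ∈ feasible A, 0 ≤ ∑ i, inner ℝ (gameMap J a i) (b i - a i)

/-- `Joint d` carries the sup norm, so the problem is moved to `PiLp 2`, whose inner product is the
sum over the blocks; equivalence of the norms keeps the map Lipschitz. -/
theorem exists_isVariational (hne : ∀ i, (A i).Nonempty) (hcv : ∀ i, Convex ℝ (A i))
    (hcp : ∀ i, IsCompact (A i)) (hmono : StrictlyMonotoneOn (gameMap J) (feasible A))
    (hlip : ∀ i, ∃ L : ℝ≥0, LipschitzWith L fun a => gameMap J a i) :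
    ∃ a, IsVariational A J a := by
  obtain ⟨L, hL⟩ := exists_lipschitzWith_gameMap hlip
  set S : Set (PiLp 2 fun i => EuclideanSpace ℝ (Fin (d i))) := {u | WithLp.ofLp u ∈ feasible A} with hS
  have hSimg : S = WithLp.toLp 2 '' feasible A := by
    ext u
    constructor
    · exact fun hu => ⟨WithLp.ofLp u, hu, rfl⟩
    · rintro ⟨a, ha, rfl⟩; exact ha
  have hScp : IsCompact S := by
    rw [hSimg]
    exact (isCompact_feasible hcp).image (PiLp.continuous_toLp 2 _)
  have hSne : S.Nonempty := by
    choose a ha using hne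
    exact ⟨WithLp.toLp 2 a, ha⟩
  have hScv : Convex ℝ S := by
    intro u hu v hv s t hs ht hst i
    exact hcv i (hu i) (hv i) hs ht hst
  have hF : LipschitzWith _ fun u : PiLp 2 (fun i => EuclideanSpace ℝ (Fin (d i))) =>
      (WithLp.toLp 2 (gameMap J (WithLp.ofLp u)) : PiLp 2 fun i => EuclideanSpace ℝ (Fin (d i))) :=
    (PiLp.lipschitzWith_toLp 2 _).comp (hL.comp (PiLp.lipschitzWith_ofLp 2 _))
  obtain ⟨u, hu, hvi⟩ := exists_variational_of_mono hSne hScv hScp hF fun a ha b hb => by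
    rcases eq_or_ne a b with rfl | hab
    · simp
    · have := hmono _ ha _ hb fun h => hab (WithLp.ofLp_injective 2 h)
      rw [PiLp.inner_apply]
      exact this.le
  refine ⟨WithLp.ofLp u, hu, fun b hb => ?_⟩
  have h := hvi (WithLp.toLp 2 b) hb
  rw [PiLp.inner_apply] at h
  exact h

/-- The strict Minty form of the inequality, with the field evaluated at the test point `b`. It
drives uniqueness, the equilibrium property and the drift of the algorithm. -/
theorem IsVariational.inner_pos (hmono : StrictlyMonotoneOn (gameMap J) (feasible A))
    {a b : Joint d} (ha : IsVariational A J a) (hb : b ∈ feasible A) (hab : b ≠ a) :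
    0 < ∑ i, inner ℝ (gameMap J b i) (b i - a i) := by
  have h1 := hmono b hb a ha.1 hab
  have h2 := ha.2 b hb
  simp only [inner_sub_left, Finset.sum_sub_distrib] at h1
  linarith

theorem IsVariational.unique (hmono : StrictlyMonotoneOn (gameMap J) (feasible A))
    {a b : Joint d} (ha : IsVariational A J a) (hb : IsVariational A J b) : b = a := by
  by_contra hab
  have h1 := ha.inner_pos hmono hb.1 hab
  have h2 := hb.2 a ha.1
  have h3 : ∑ i, inner ℝ (gameMap J b i) (a i - b i) =
      - ∑ i, inner ℝ (gameMap J b i) (b i - a i) := by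
    rw [← Finset.sum_neg_distrib]
    exact Finset.sum_congr rfl fun i _ => by rw [← inner_neg_right, neg_sub]
  linarith

theorem hasGradientAt_update (hJ : ∀ i, ContDiff ℝ 1 (J i)) (a : Joint d) (i : Fin N)
    (y : EuclideanSpace ℝ (Fin (d i))) :
    HasGradientAt (fun z => J i (Function.update a i z))
      (gameMap J (Function.update a i y) i) y := by
  have hd : DifferentiableAt ℝ (fun z => J i (Function.update a i z)) y :=
    (((hJ i).differentiable one_ne_zero) _).comp y
      (hasFDerivAt_update a y).differentiableAt
  simpa [gameMap] using hd.hasGradientAt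

theorem hasDerivAt_line (hJ : ∀ i, ContDiff ℝ 1 (J i)) (a : Joint d) (i : Fin N)
    (y v : EuclideanSpace ℝ (Fin (d i))) (s : ℝ) :
    HasDerivAt (fun s : ℝ => J i (Function.update a i (y + s • v)))
      (inner ℝ (gameMap J (Function.update a i (y + s • v)) i) v) s := by
  have h1 := (hasGradientAt_update hJ a i (y + s • v)).hasFDerivAt
  have h2 : HasDerivAt (fun s : ℝ => y + s • v) v s := by
    simpa using ((hasDerivAt_id s).smul_const v).const_add y
  have h3 := h1.comp_hasDerivAt s h2
  rw [InnerProductSpace.toDual_apply_apply] at h3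
  exact h3

/-- By the mean value theorem the change of cost is a directional derivative at an intermediate
point of the segment. That point differs from `a` in block `i` only, so the sum in `inner_pos`
reduces to this derivative times `s`. -/
theorem IsVariational.isNash (hJ : ∀ i, ContDiff ℝ 1 (J i)) (hcv : ∀ i, Convex ℝ (A i))
    (hmono : StrictlyMonotoneOn (gameMap J) (feasible A)) {a : Joint d}
    (ha : IsVariational A J a) : IsNash A J a := by
  refine ⟨ha.1, fun i y hy => ?_⟩
  obtain ⟨s, hs, hs'⟩ := exists_hasDerivAt_eq_slope
    (fun s : ℝ => J i (Function.update a i (a i + s • (y - a i)))) _ zero_lt_one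
    (continuous_iff_continuousAt.2 fun s =>
      (hasDerivAt_line hJ a i (a i) (y - a i) s).continuousAt).continuousOn
    fun s _ => hasDerivAt_line hJ a i (a i) (y - a i) s
  simp only [one_smul, add_sub_cancel, zero_smul, add_zero, Function.update_eq_self, sub_zero,
    div_one] at hs'
  have hmem : Function.update a i (a i + s • (y - a i)) ∈ feasible A :=
    update_mem_feasible ha.1 ((hcv i).add_smul_sub_mem (ha.1 i) hy ⟨hs.1.le, hs.2.le⟩)
  have hnonneg : 0 ≤ s * inner ℝ (gameMap J (Function.update a i (a i + s • (y - a i))) i)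
      (y - a i) := by
    rcases eq_or_ne (Function.update a i (a i + s • (y - a i))) a with h | h
    · have hz := congrFun h i
      simp only [Function.update_self, add_eq_left] at hz
      rw [← real_inner_smul_right, hz, inner_zero_right]
    · have hp := ha.inner_pos hmono hmem h
      rw [Finset.sum_eq_single i] at hp
      · simpa [inner_smul_right] using hp.le
      · intro j _ hj; simp [hj]
      · simp
  have := nonneg_of_mul_nonneg_right hnonneg hs.1
  linarith

/-- First-order condition: along each feasible segment of one player the cost is smallest at the
start, so its right derivative there is nonnegative. -/
theorem IsNash.isVariational (hJ : ∀ i, ContDiff ℝ 1 (J i)) (hcv : ∀ i, Convex ℝ (A i))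
    {a : Joint d} (ha : IsNash A J a) : IsVariational A J a := by
  refine ⟨ha.1, fun b hb => Finset.sum_nonneg fun i _ => ?_⟩
  have hd := hasDerivAt_line hJ a i (a i) (b i - a i) 0
  simp only [zero_smul, add_zero, Function.update_eq_self] at hd
  by_contra! hneg
  have hlim := hd.tendsto_slope_zero_right
  obtain ⟨s, hs1, hs2⟩ := ((hlim.eventually_lt_const hneg).and
    (Ioc_mem_nhdsGT (zero_lt_one' ℝ))).exists
  simp only [zero_add, zero_smul, add_zero, Function.update_eq_self, smul_eq_mul] at hs1
  have h := ha.2 i _ ((hcv i).add_smul_sub_mem (ha.1 i) (hb i) ⟨hs2.1.le, hs2.2⟩)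
  have := mul_nonneg (inv_nonneg.2 hs2.1.le) (sub_nonneg.2 h)
  linarith

/-- Away from the solution of the variational inequality the drift is bounded below. -/
theorem IsVariational.exists_drift_bound (hcp : ∀ i, IsCompact (A i))
    (hmono : StrictlyMonotoneOn (gameMap J) (feasible A)) (hc : Continuous (gameMap J))
    {a : Joint d} (ha : IsVariational A J a) {ε : ℝ} (hε : 0 < ε) :
    ∃ δ > 0, ∀ b ∈ feasible A, ε ≤ ∑ i, ‖b i - a i‖ ^ 2 →
      δ ≤ ∑ i, inner ℝ (gameMap J b i) (b i - a i) := by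
  set S := feasible A ∩ {b | ε ≤ ∑ i, ‖b i - a i‖ ^ 2} with hS
  have hScp : IsCompact S := (isCompact_feasible hcp).inter_right
    (isClosed_le continuous_const (by fun_prop))
  rcases S.eq_empty_or_nonempty with h | h
  · refine ⟨1, one_pos, fun b hb hb' => ?_⟩
    exact absurd (show b ∈ S from ⟨hb, hb'⟩) (by simp [h])
  · obtain ⟨b, hb, hmin⟩ := hScp.exists_isMinOn h
      (f := fun b => ∑ i, inner ℝ (gameMap J b i) (b i - a i)) (by
        refine Continuous.continuousOn (continuous_finsetSum _ fun i _ => ?_)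
        exact ((continuous_apply i).comp hc).inner (by fun_prop))
    refine ⟨_, ha.inner_pos hmono hb.1 ?_, fun c hc hc' => hmin ⟨hc, hc'⟩⟩
    rintro rfl
    have := hb.2
    simp at this
    linarith

end Game

/-! ### The standard Gaussian: moments, symmetry, covariance -/

section Gaussian

/-- The standard normal distribution of joint actions. -/
def stdLaw (d : Fin N → ℕ) : Measure (Joint d) :=
  Measure.pi fun i => stdGaussian (EuclideanSpace ℝ (Fin (d i)))

instance : IsProbabilityMeasure (stdLaw d) := by unfold stdLaw; infer_instance

/-- The joint action with block `i` equal to `m i + s i • z i`. -/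
def sample (m : Joint d) (s : Fin N → ℝ) (z : Joint d) : Joint d := fun i => m i + s i • z i

theorem continuous_sample (s : Fin N → ℝ) :
    Continuous fun p : Joint d × Joint d => sample p.1 s p.2 := by
  unfold sample; fun_prop

theorem gaussianReal_eq_map (m s : ℝ) :
    gaussianReal m (Real.toNNReal (s ^ 2)) = (gaussianReal 0 1).map fun y => m + s * y := by
  have : (fun y => m + s * y) = (fun y => m + y) ∘ fun y => s * y := rfl
  rw [this, ← Measure.map_map (by fun_prop) (by fun_prop), gaussianReal_map_const_mul,
    gaussianReal_map_const_add]
  congr 1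
  · simp
  · ext; simp [Real.coe_toNNReal _ (sq_nonneg s)]

/-- Reparametrisation by one fixed law, so that moment bounds can be uniform in means and standard
deviations. -/
theorem normalLaw_eq_map (m : Joint d) (s : Fin N → ℝ) :
    normalLaw m s = (stdLaw d).map (sample m s) := by
  have h : ∀ i, (Measure.pi fun k : Fin (d i) =>
      gaussianReal (m i k) (Real.toNNReal (s i ^ 2))).map (WithLp.toLp 2) =
      (stdGaussian (EuclideanSpace ℝ (Fin (d i)))).map fun y => m i + s i • y := by
    intro i
    simp_rw [gaussianReal_eq_map]
    have hp : ∀ k : Fin (d i), IsProbabilityMeasure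
        ((gaussianReal 0 1).map fun y => m i k + s i * y) := fun k =>
      Measure.isProbabilityMeasure_map (by fun_prop)
    rw [← Measure.pi_map_pi (by fun_prop), Measure.map_map (by fun_prop) (by fun_prop),
      ← map_pi_eq_stdGaussian, Measure.map_map (by fun_prop) (by fun_prop)]
    rfl
  have hp : ∀ i, IsProbabilityMeasure
      ((stdGaussian (EuclideanSpace ℝ (Fin (d i)))).map fun y => m i + s i • y) := fun i =>
    Measure.isProbabilityMeasure_map (by fun_prop)
  unfold normalLaw stdLaw
  simp_rw [h]
  rw [← Measure.pi_map_pi (by fun_prop)]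
  rfl

theorem measurePreserving_eval_stdLaw (i : Fin N) :
    MeasurePreserving (fun z : Joint d => z i) (stdLaw d)
      (stdGaussian (EuclideanSpace ℝ (Fin (d i)))) :=
  measurePreserving_eval (fun i => stdGaussian (EuclideanSpace ℝ (Fin (d i)))) i

theorem memLp_id_stdGaussian {E : Type*} [NormedAddCommGroup E] [InnerProductSpace ℝ E]
    [FiniteDimensional ℝ E] [MeasurableSpace E] [BorelSpace E] {p : ℝ≥0∞} (hp : p ≠ ∞) :
    MemLp (fun x => x) p (stdGaussian E) :=
  IsGaussian.memLp_id (stdGaussian E) p hp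

theorem memLp_stdLaw (p : ℝ≥0∞) (hp : p ≠ ∞) : MemLp (fun z => z) p (stdLaw d) := by
  refine MemLp.of_eval fun i => ?_
  have h := (memLp_id_stdGaussian (E := EuclideanSpace ℝ (Fin (d i))) hp)
  rw [← (measurePreserving_eval_stdLaw i).map_eq] at h
  have h2 := h.comp_of_map (measurable_pi_apply i).aemeasurable
  exact h2

theorem integrable_one_add_norm_pow (p : ℕ) :
    Integrable (fun z => (1 + ‖z‖) ^ p) (stdLaw d) := by
  have h0 : MemLp (fun z : Joint d => ‖z‖) p (stdLaw d) :=
    (memLp_stdLaw p (ENNReal.natCast_ne_top p)).norm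
  have h : MemLp ((fun _ : Joint d => (1 : ℝ)) + fun z : Joint d => ‖z‖) p (stdLaw d) :=
    (memLp_const (1 : ℝ)).add h0
  refine h.integrable_norm_pow'.congr (ae_of_all _ fun z => ?_)
  simp only [Pi.add_apply]
  rw [Real.norm_of_nonneg (by positivity)]

theorem integrable_norm_pow_stdLaw (p : ℕ) : Integrable (fun z => ‖z‖ ^ p) (stdLaw d) :=
  (memLp_stdLaw p (by simp)).integrable_norm_pow'

/-- Change of sign of block `i`. -/
def flip (i : Fin N) (z : Joint d) : Joint d := fun j => if j = i then -z j else z j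

theorem measurePreserving_flip (i : Fin N) :
    MeasurePreserving (flip i) (stdLaw d) (stdLaw d) := by
  unfold stdLaw
  refine measurePreserving_pi (f := fun j (y : EuclideanSpace ℝ (Fin (d j))) =>
    if j = i then -y else y) _ _ fun j => ?_
  by_cases h : j = i
  · simp only [h, if_true]
    exact ⟨measurable_neg, stdGaussian_map
      (LinearIsometryEquiv.neg ℝ (E := EuclideanSpace ℝ (Fin (d j))))⟩
  · simp only [h, if_false]
    exact MeasurePreserving.id _

/-- The covariance is the identity; this is what makes the score reproduce the gradient. -/
theorem integral_inner_mul_inner (i : Fin N) (v w : EuclideanSpace ℝ (Fin (d i))) :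
    ∫ z, inner ℝ v (z i) * inner ℝ w (z i) ∂stdLaw d = inner ℝ v w := by
  have h := covarianceBilin_apply
    (IsGaussian.memLp_two_id (μ := stdGaussian (EuclideanSpace ℝ (Fin (d i))))) v w
  rw [covarianceBilin_stdGaussian] at h
  have h0 : (stdGaussian (EuclideanSpace ℝ (Fin (d i))))[id] = 0 := integral_id_stdGaussian
  rw [h0] at h
  simp only [sub_zero] at h
  have h' : inner ℝ v w = _ := h
  rw [h']
  have hmp := measurePreserving_eval_stdLaw (d := d) i
  rw [← hmp.map_eq, integral_map hmp.measurable.aemeasurable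
    (Continuous.aestronglyMeasurable (by fun_prop))]

theorem integrable_inner_mul_inner (i : Fin N) (v w : EuclideanSpace ℝ (Fin (d i))) :
    Integrable (fun z => inner ℝ v (z i) * inner ℝ w (z i)) (stdLaw d) := by
  refine ((integrable_norm_pow_stdLaw (d := d) 2).const_mul (‖v‖ * ‖w‖)).mono'
    (Continuous.aestronglyMeasurable (by fun_prop)) (ae_of_all _ fun z => ?_)
  rw [norm_mul]
  have h1 := norm_inner_le_norm (𝕜 := ℝ) v (z i)
  have h2 := norm_inner_le_norm (𝕜 := ℝ) w (z i)
  have h3 := norm_le_pi_norm z i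
  calc _ ≤ (‖v‖ * ‖z‖) * (‖w‖ * ‖z‖) := by
        refine mul_le_mul (h1.trans ?_) (h2.trans ?_) (norm_nonneg _) (by positivity) <;> gcongr
    _ = _ := by ring

end Gaussian

/-! ### Growth of the costs and bias of the gradient estimate -/

section Costs

variable {J : Fin N → Joint d → ℝ}

/-- Linearisation of a cost in the own action, with error controlled by the distance to the
base point `m`. -/
theorem abs_cost_sub_sub_inner_le (hJ : ∀ i, ContDiff ℝ 1 (J i)) {i : Fin N} {L : ℝ≥0}
    (hL : LipschitzWith L fun a => gameMap J a i) {a m : Joint d} {ρ : ℝ} (hρ : 0 ≤ ρ)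
    (ha : ∀ j, j ≠ i → ‖a j - m j‖ ≤ ρ) {y y' : EuclideanSpace ℝ (Fin (d i))}
    (hy : ‖y - m i‖ ≤ ρ) (hy' : ‖y' - m i‖ ≤ ρ) :
    |J i (Function.update a i y') - J i (Function.update a i y) -
      inner ℝ (gameMap J m i) (y' - y)| ≤ L * ρ * ‖y' - y‖ := by
  have h := (convex_closedBall (m i) ρ).norm_image_sub_le_of_norm_hasFDerivWithin_le'
    (f := fun z => J i (Function.update a i z)) (C := L * ρ)
    (φ := InnerProductSpace.toDual ℝ _ (gameMap J m i))
    (fun z _ => (hasGradientAt_update hJ a i z).hasFDerivAt.hasFDerivWithinAt)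
    (fun z hz => by
      rw [← map_sub, LinearIsometryEquiv.norm_map, ← dist_eq_norm]
      refine (hL.dist_le_mul _ _).trans ?_
      gcongr
      refine (dist_pi_le_iff hρ).2 fun j => ?_
      rcases eq_or_ne j i with rfl | hj
      · simpa using hz
      · simpa [hj, dist_eq_norm] using ha j hj)
    (x := y) (y := y') (by simpa [dist_eq_norm] using hy) (by simpa [dist_eq_norm] using hy')
  simpa only [InnerProductSpace.toDual_apply_apply, Real.norm_eq_abs] using h

/-- Polynomial growth of the cost times the own perturbation; the factor `v` matters only for a
player whose action space is trivial. -/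
theorem exists_growth_bound (hJ : ∀ i, ContDiff ℝ 1 (J i)) {i : Fin N} {L : ℝ≥0}
    (hL : LipschitzWith L fun a => gameMap J a i) (hg : GrowsQuadratically J i) :
    ∃ (C : ℝ) (p : ℕ), 0 ≤ C ∧ ∀ (a : Joint d) (v : EuclideanSpace ℝ (Fin (d i))),
      |J i a| * ‖v‖ ≤ C * (1 + ‖a‖) ^ p * ‖v‖ := by
  obtain ⟨K, Q, m, hK⟩ := hg
  have hgrow : ∀ a : Joint d, Q ≤ ‖a i‖ → ∀ T, ‖a i‖ ≤ T → ∀ b : Joint d,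
      (∀ j, j ≠ i → a j = b j) →
      |J i a| ≤ |K| * (N + 1) ^ m * (1 + ‖b‖) ^ m * (1 + T ^ 2) := by
    intro a ha T hT b hab
    refine (hK a ha).trans ?_
    have h1 : 1 + ∑ j ∈ Finset.univ.erase i, ‖a j‖ ≤ (N + 1) * (1 + ‖b‖) := by
      have : ∑ j ∈ Finset.univ.erase i, ‖a j‖ ≤ N * ‖b‖ := by
        calc ∑ j ∈ Finset.univ.erase i, ‖a j‖ ≤ ∑ j ∈ Finset.univ.erase i, ‖b‖ :=
              Finset.sum_le_sum fun j hj => by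
                rw [hab j (Finset.ne_of_mem_erase hj)]; exact norm_le_pi_norm b j
          _ ≤ ∑ j : Fin N, ‖b‖ :=
              Finset.sum_le_sum_of_subset_of_nonneg (Finset.erase_subset _ _)
                fun _ _ _ => norm_nonneg _
          _ = N * ‖b‖ := by simp
      have := norm_nonneg b
      nlinarith [(Nat.cast_nonneg N : (0 : ℝ) ≤ N)]
    have h0 : 0 ≤ 1 + ∑ j ∈ Finset.univ.erase i, ‖a j‖ := by positivity
    calc K * (1 + ∑ j ∈ Finset.univ.erase i, ‖a j‖) ^ m * (1 + ‖a i‖ ^ 2)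
        ≤ |K| * ((N + 1) * (1 + ‖b‖)) ^ m * (1 + T ^ 2) := by
          gcongr
          exact le_abs_self K
      _ = _ := by rw [mul_pow]; ring
  set G : ℝ := ‖gameMap J 0 i‖ with hG
  -- The first summand comes from the growth hypothesis, the second from a linearisation over a
  -- distance of at most `2 * Q`; the latter matters only when `‖a i‖ < Q`.
  refine ⟨|K| * (N + 1) ^ m * (1 + Q ^ 2) + (G + L * (1 + |Q|)) * (2 * |Q|), m + 2,
    by positivity, fun a v => ?_⟩
  rcases eq_or_ne (‖v‖) 0 with hv | hv
  · simp [hv]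
  refine mul_le_mul_of_nonneg_right ?_ (norm_nonneg v)
  have ha1 : 1 ≤ 1 + ‖a‖ := by linarith [norm_nonneg a]
  rcases le_or_gt Q ‖a i‖ with hQ | hQ
  · refine (hgrow a hQ ‖a‖ (norm_le_pi_norm a i) a fun _ _ => rfl).trans ?_
    have h2 : 1 + ‖a‖ ^ 2 ≤ (1 + Q ^ 2) * (1 + ‖a‖) ^ 2 := by
      have := norm_nonneg a
      nlinarith [sq_nonneg Q, mul_nonneg (sq_nonneg Q) (sq_nonneg (1 + ‖a‖))]
    calc |K| * (N + 1) ^ m * (1 + ‖a‖) ^ m * (1 + ‖a‖ ^ 2)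
        ≤ |K| * (N + 1) ^ m * (1 + ‖a‖) ^ m * ((1 + Q ^ 2) * (1 + ‖a‖) ^ 2) := by gcongr
      _ = (|K| * (N + 1) ^ m * (1 + Q ^ 2) + 0) * (1 + ‖a‖) ^ (m + 2) := by ring
      _ ≤ _ := by
          gcongr
          positivity
  · have hQ0 : 0 ≤ Q := (norm_nonneg _).trans hQ.le
    rw [abs_of_nonneg hQ0]
    -- For a small own action the growth hypothesis is silent. The action is replaced by one of norm
    -- exactly `Q`, which needs a nonzero direction `v`, and the cost is carried back by
    -- linearisation at `0`.
    set e : EuclideanSpace ℝ (Fin (d i)) := (Q / ‖v‖) • v with he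
    have hne : ‖e‖ = Q := by
      rw [he, norm_smul, Real.norm_of_nonneg (by positivity), div_mul_cancel₀ _ hv]
    have h1 := hgrow (Function.update a i e) (by simp [hne]) Q (by simp [hne]) a
      fun j hj => by simp [hj]
    have h2 := abs_cost_sub_sub_inner_le hJ hL (a := a) (m := 0) (ρ := ‖a‖ + Q) (by positivity)
      (fun j _ => by simpa using (norm_le_pi_norm a j).trans (by linarith)) (y := e) (y' := a i)
      (by simp [hne]) (by simpa using (norm_le_pi_norm a i).trans (by linarith))
    rw [Function.update_eq_self] at h2
    have h3 : ‖a i - e‖ ≤ 2 * Q := (norm_sub_le _ _).trans (by rw [hne]; linarith)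
    have h4 : |inner ℝ (gameMap J 0 i) (a i - e)| ≤ G * (2 * Q) :=
      (abs_real_inner_le_norm _ _).trans (by gcongr)
    have h5 : (L : ℝ) * (‖a‖ + Q) * ‖a i - e‖ ≤ L * (‖a‖ + Q) * (2 * Q) := by gcongr
    have h6 : |J i a| ≤ |K| * (N + 1) ^ m * (1 + ‖a‖) ^ m * (1 + Q ^ 2) +
        (G + L * (‖a‖ + Q)) * (2 * Q) := by
      rw [abs_le] at h1 h2 h4 ⊢
      constructor <;> linarith
    refine h6.trans ?_
    have h7 : (1 + ‖a‖) ^ m ≤ (1 + ‖a‖) ^ (m + 2) := pow_le_pow_right₀ ha1 (by omega)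
    have h8 : 1 ≤ (1 + ‖a‖) ^ (m + 2) := one_le_pow₀ ha1
    have h9 : 1 + ‖a‖ ≤ (1 + ‖a‖) ^ (m + 2) := le_self_pow₀ ha1 (by omega)
    have h11 : |K| * (N + 1) ^ m * (1 + ‖a‖) ^ m * (1 + Q ^ 2) ≤
        |K| * (N + 1) ^ m * (1 + Q ^ 2) * (1 + ‖a‖) ^ (m + 2) := by
      rw [mul_right_comm]
      gcongr
    have h12 : (G + L * (‖a‖ + Q)) * (2 * Q) ≤
        (G + L * (1 + Q)) * (2 * Q) * (1 + ‖a‖) ^ (m + 2) := by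
      have h10 : G + L * (‖a‖ + Q) ≤ (G + L * (1 + Q)) * (1 + ‖a‖) ^ (m + 2) := by
        calc G + L * (‖a‖ + Q) ≤ (G + L * (1 + Q)) * (1 + ‖a‖) := by
              have hG0 : 0 ≤ G := norm_nonneg _
              have := norm_nonneg a
              have hL0 : (0 : ℝ) ≤ L := L.2
              nlinarith [mul_nonneg hG0 this, mul_nonneg (mul_nonneg hL0 hQ0) this]
          _ ≤ _ := by gcongr
      calc (G + L * (‖a‖ + Q)) * (2 * Q)
          ≤ (G + L * (1 + Q)) * (1 + ‖a‖) ^ (m + 2) * (2 * Q) := by gcongr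
        _ = _ := by ring
    exact (add_le_add h11 h12).trans_eq (by ring)

theorem norm_sample_le {m : Joint d} {s : Fin N → ℝ} {R S : ℝ} (hm : ‖m‖ ≤ R) (hS0 : 0 ≤ S)
    (hs : ∀ j, |s j| ≤ S) (z : Joint d) : ‖sample m s z‖ ≤ R + S * ‖z‖ := by
  have hR : 0 ≤ R := (norm_nonneg m).trans hm
  refine (pi_norm_le_iff_of_nonneg (by positivity)).2 fun j => (norm_add_le _ _).trans ?_
  refine add_le_add ((norm_le_pi_norm m j).trans hm) ?_
  rw [norm_smul]
  exact mul_le_mul (hs j) (norm_le_pi_norm z j) (norm_nonneg _) hS0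

/-- The sampled cost times the own perturbation is dominated by one square integrable function,
uniformly over bounded means and standard deviations. -/
theorem exists_score_bound (hJ : ∀ i, ContDiff ℝ 1 (J i))
    (hlip : ∀ i, ∃ L : ℝ≥0, LipschitzWith L fun a => gameMap J a i)
    (hg : ∀ i, GrowsQuadratically J i) (i : Fin N) {R S : ℝ} (hR : 0 ≤ R) (hS : 0 ≤ S) :
    ∃ Φ : Joint d → ℝ, MemLp Φ 2 (stdLaw d) ∧ ∀ m : Joint d, ‖m‖ ≤ R → ∀ s : Fin N → ℝ,
      (∀ j, |s j| ≤ S) → ∀ z, |J i (sample m s z)| * ‖z i‖ ≤ Φ z := by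
  obtain ⟨L, hL⟩ := hlip i
  obtain ⟨C, p, hC, h⟩ := exists_growth_bound hJ hL (hg i)
  set c : ℝ := 1 + R + S with hc
  have hc1 : 1 ≤ c := by linarith
  refine ⟨fun z => C * c ^ p * (1 + ‖z‖) ^ (p + 1), ?_, fun m hm s hs z => ?_⟩
  · refine (memLp_two_iff_integrable_sq (Continuous.aestronglyMeasurable (by fun_prop))).2 ?_
    refine ((integrable_one_add_norm_pow (d := d) (2 * (p + 1))).const_mul
      ((C * c ^ p) ^ 2)).congr (ae_of_all _ fun z => ?_)
    simp only
    ring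
  · have h1 : 1 + ‖sample m s z‖ ≤ c * (1 + ‖z‖) := by
      have := norm_sample_le hm hS hs z
      have := norm_nonneg z
      nlinarith
    have h2 : ‖z i‖ ≤ 1 + ‖z‖ := (norm_le_pi_norm z i).trans (by linarith)
    calc |J i (sample m s z)| * ‖z i‖ ≤ C * (1 + ‖sample m s z‖) ^ p * ‖z i‖ := h _ _
      _ ≤ C * (c * (1 + ‖z‖)) ^ p * (1 + ‖z‖) := by gcongr
      _ = _ := by rw [mul_pow]; ring

theorem sample_flip (m : Joint d) (s : Fin N → ℝ) (z : Joint d) (i : Fin N) :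
    sample m s (flip i z) = Function.update (sample m s z) i (m i - s i • z i) := by
  funext j
  rcases eq_or_ne j i with rfl | hj
  · simp [sample, flip, sub_eq_add_neg]
  · simp [sample, flip, hj]

/-- The bias of the score: the expectation of the sampled cost times the own perturbation is
`s i` times the partial gradient at the mean, up to an error of second order. -/
theorem abs_integral_score_sub_le (hJ : ∀ i, ContDiff ℝ 1 (J i)) {i : Fin N} {L : ℝ≥0}
    (hL : LipschitzWith L fun a => gameMap J a i) {m : Joint d} {s : Fin N → ℝ} {S : ℝ}
    (hs0 : ∀ j, 0 ≤ s j) (hs : ∀ j, s j ≤ S) (v : EuclideanSpace ℝ (Fin (d i)))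
    (hint : Integrable (fun z => J i (sample m s z) * inner ℝ v (z i)) (stdLaw d)) :
    |∫ z, J i (sample m s z) * inner ℝ v (z i) ∂stdLaw d - s i * inner ℝ (gameMap J m i) v| ≤
      L * S * s i * ‖v‖ * ∫ z, ‖z‖ ^ 3 ∂stdLaw d := by
  set f : Joint d → ℝ := fun z => J i (sample m s z) * inner ℝ v (z i) with hf
  have hS0 : 0 ≤ S := (hs0 i).trans (hs i)
  have hmp := measurePreserving_flip (d := d) i
  have hint' : Integrable (fun z => f (flip i z)) (stdLaw d) :=
    hmp.integrable_comp_of_integrable hint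
  have hflip : ∫ z, f (flip i z) ∂stdLaw d = ∫ z, f z ∂stdLaw d := by
    rw [← integral_map hmp.measurable.aemeasurable (by rw [hmp.map_eq]; exact hint.1), hmp.map_eq]
  have hquad := integrable_inner_mul_inner i (gameMap J m i) v
  -- Averaging over `z` and `flip i z` turns the cost into a central difference in the own block.
  -- The value of the cost at the mean cancels, and the linear part integrates exactly to the
  -- subtracted term.
  have hrw : ∫ z, f z ∂stdLaw d - s i * inner ℝ (gameMap J m i) v =
      ∫ z, ((f z + f (flip i z)) / 2 -
        s i * (inner ℝ (gameMap J m i) (z i) * inner ℝ v (z i))) ∂stdLaw d := by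
    have hadd : Integrable (fun z => (f z + f (flip i z)) / 2) (stdLaw d) :=
      (hint.add hint').div_const 2
    rw [integral_sub hadd (hquad.const_mul _), integral_div,
      integral_add hint hint', hflip, integral_const_mul, integral_inner_mul_inner]
    ring
  rw [hrw, ← Real.norm_eq_abs, ← integral_const_mul]
  refine norm_integral_le_of_norm_le ((integrable_norm_pow_stdLaw 3).const_mul _)
    (ae_of_all _ fun z => ?_)
  have hz := norm_le_pi_norm z i
  have hρ : 0 ≤ S * ‖z‖ := by positivity
  have hmove : ∀ j, ‖s j • z j‖ ≤ S * ‖z‖ := fun j => by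
    rw [norm_smul, Real.norm_of_nonneg (hs0 j)]
    exact mul_le_mul (hs j) (norm_le_pi_norm z j) (norm_nonneg _) hS0
  -- Both sampled points lie within `S * ‖z‖` of `m` in every block and `2 * s i * ‖z i‖` apart;
  -- with the factor `inner ℝ v (z i)` this produces the third moment.
  have h := abs_cost_sub_sub_inner_le hJ hL (a := sample m s z) (m := m) hρ
    (fun j _ => by simpa [sample] using hmove j) (y := m i - s i • z i)
    (y' := sample m s z i) (by simpa using hmove i) (by simpa [sample] using hmove i)
  rw [Function.update_eq_self, ← sample_flip] at h
  have hdiff : sample m s z i - (m i - s i • z i) = (2 * s i) • z i := by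
    simp only [sample]; module
  rw [hdiff, inner_smul_right, norm_smul, Real.norm_of_nonneg (by linarith [hs0 i])] at h
  have hfl : inner ℝ v (flip i z i) = - inner ℝ v (z i) := by simp [flip, inner_neg_right]
  have he : (f z + f (flip i z)) / 2 -
      s i * (inner ℝ (gameMap J m i) (z i) * inner ℝ v (z i)) =
      (J i (sample m s z) - J i (sample m s (flip i z)) -
        2 * s i * inner ℝ (gameMap J m i) (z i)) / 2 * inner ℝ v (z i) := by
    simp only [hf]
    rw [hfl]
    ring
  rw [he, norm_mul, Real.norm_eq_abs, abs_div, abs_two]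
  have h2 := norm_inner_le_norm (𝕜 := ℝ) v (z i)
  have hsi := hs0 i
  calc _ ≤ (L * (S * ‖z‖) * (2 * s i * ‖z i‖)) / 2 * (‖v‖ * ‖z i‖) := by
        refine mul_le_mul (by gcongr) h2 (norm_nonneg _) (by positivity)
    _ ≤ (L * (S * ‖z‖) * (2 * s i * ‖z‖)) / 2 * (‖v‖ * ‖z‖) := by
        gcongr
    _ = _ := by ring

end Costs

/-! ### Almost sure convergence of random series -/

section Martingale

theorem ae_summable_of_summable_integral {Ω : Type*} {mΩ : MeasurableSpace Ω} {P : Measure Ω}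
    {f : ℕ → Ω → ℝ} (hf : ∀ t ω, 0 ≤ f t ω)
    (hint : ∀ t, Integrable (f t) P) (hsum : Summable fun t => ∫ ω, f t ω ∂P) :
    ∀ᵐ ω ∂P, Summable fun t => f t ω := by
  have h1 : ∫⁻ ω, ∑' t, ENNReal.ofReal (f t ω) ∂P ≠ ∞ := by
    rw [lintegral_tsum fun t => (hint t).1.aemeasurable.ennreal_ofReal]
    have : ∀ t, ∫⁻ ω, ENNReal.ofReal (f t ω) ∂P = ENNReal.ofReal (∫ ω, f t ω ∂P) := fun t =>
      (ofReal_integral_eq_lintegral_ofReal (hint t) (ae_of_all _ (hf t))).symm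
    simp_rw [this]
    exact hsum.tsum_ofReal_ne_top
  have h2 := ae_lt_top' (AEMeasurable.tsum
    fun t => (hint t).1.aemeasurable.ennreal_ofReal) h1
  filter_upwards [h2] with ω hω
  refine (ENNReal.summable_toReal hω.ne).congr fun t => ?_
  exact ENNReal.toReal_ofReal (hf t ω)

variable {Ω : Type*} {mΩ : MeasurableSpace Ω} {P : Measure Ω} [IsProbabilityMeasure P]

/-- A series of orthogonal martingale increments with summable variances converges almost
surely. -/
theorem ae_tendsto_sum_of_orthogonal {ℱ : Filtration ℕ mΩ} {ξ : ℕ → Ω → ℝ}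
    (hmeas : ∀ t, StronglyMeasurable[ℱ (t + 1)] (ξ t)) (hL2 : ∀ t, MemLp (ξ t) 2 P)
    (horth : ∀ t, ∀ g : Ω → ℝ, StronglyMeasurable[ℱ t] g → MemLp g 2 P →
      ∫ ω, g ω * ξ t ω ∂P = 0)
    (hsum : Summable fun t => ∫ ω, ξ t ω ^ 2 ∂P) :
    ∀ᵐ ω ∂P, ∃ l, Tendsto (fun n => ∑ t ∈ Finset.range n, ξ t ω) atTop (𝓝 l) := by
  set M : ℕ → Ω → ℝ := fun n ω => ∑ t ∈ Finset.range n, ξ t ω with hM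
  have hM2 : ∀ n, MemLp (M n) 2 P := fun n => memLp_finsetSum _ fun t _ => hL2 t
  have hMint : ∀ n, Integrable (M n) P := fun n => (hM2 n).integrable one_le_two
  have hξint : ∀ n, Integrable (ξ n) P := fun n => (hL2 n).integrable one_le_two
  have hMadp : ∀ n, StronglyMeasurable[ℱ n] (M n) := fun n =>
    Finset.stronglyMeasurable_fun_sum _ fun t ht =>
      (hmeas t).mono (ℱ.mono (Finset.mem_range.1 ht))
  have hmart : Martingale M ℱ P := by
    refine martingale_of_setIntegral_eq_succ hMadp hMint fun n S hS => ?_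
    have hSm := ℱ.le n S hS
    have h0 : ∫ ω in S, ξ n ω ∂P = 0 := by
      rw [← integral_indicator hSm, ← horth n (S.indicator fun _ => 1)
        (stronglyMeasurable_const.indicator hS) ((memLp_const 1).indicator hSm)]
      refine integral_congr_ae (ae_of_all _ fun ω => ?_)
      by_cases h : ω ∈ S <;> simp [h]
    have h1 : ∀ ω, M (n + 1) ω = M n ω + ξ n ω := fun ω => by
      simp only [hM, Finset.sum_range_succ]
    simp_rw [h1]
    rw [integral_add (hMint n).integrableOn (hξint n).integrableOn, h0, add_zero]
  -- Pythagoras: the cross terms vanish by orthogonality. With `|M| ≤ 1 + M ^ 2` this gives the L¹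
  -- bound required for martingale convergence.
  have hsq : ∀ n, ∫ ω, M n ω ^ 2 ∂P = ∑ t ∈ Finset.range n, ∫ ω, ξ t ω ^ 2 ∂P := by
    intro n
    induction n with
    | zero => simp [hM]
    | succ n ih =>
      have h1 : ∀ ω, M (n + 1) ω ^ 2 = M n ω ^ 2 + 2 * (M n ω * ξ n ω) + ξ n ω ^ 2 := fun ω => by
        simp only [hM, Finset.sum_range_succ]; ring
      have h2 : Integrable (fun ω => 2 * (M n ω * ξ n ω)) P :=
        ((hM2 n).integrable_mul (hL2 n)).const_mul 2
      simp_rw [h1]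
      have h3 : Integrable (fun ω => M n ω ^ 2 + 2 * (M n ω * ξ n ω)) P :=
        (hM2 n).integrable_sq.add h2
      rw [integral_add h3 (hL2 n).integrable_sq,
        integral_add (hM2 n).integrable_sq h2, integral_const_mul,
        horth n (M n) (hMadp n) (hM2 n), ih, Finset.sum_range_succ]
      ring
  refine hmart.submartingale.exists_ae_tendsto_of_bdd
    (R := Real.toNNReal (1 + ∑' t, ∫ ω, ξ t ω ^ 2 ∂P)) fun n => ?_
  rw [eLpNorm_one_eq_lintegral_enorm, ← ofReal_integral_norm_eq_lintegral_enorm (hMint n)]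
  refine ENNReal.ofReal_le_ofReal ?_
  calc ∫ ω, ‖M n ω‖ ∂P ≤ ∫ ω, (1 + M n ω ^ 2) ∂P := by
        refine integral_mono (hMint n).norm ((integrable_const 1).add (hM2 n).integrable_sq)
          fun ω => ?_
        simp only [Real.norm_eq_abs]
        nlinarith [sq_abs (M n ω), sq_nonneg (|M n ω| - 1)]
    _ = 1 + ∑ t ∈ Finset.range n, ∫ ω, ξ t ω ^ 2 ∂P := by
        rw [integral_add (integrable_const 1) (hM2 n).integrable_sq, hsq]
        simp
    _ ≤ _ := by
        gcongr
        exact hsum.sum_le_tsum _ fun t _ => integral_nonneg fun ω => sq_nonneg _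

end Martingale

/-! ### The standardised perturbation and its independence of the past -/

section Noise

variable {Ω : Type*} {m mΩ : MeasurableSpace Ω} {P : Measure Ω}
  {μ x : Ω → Joint d} {s : Fin N → ℝ}

/-- The standardised perturbation of a state `x` around its mean `μ`. -/
def noise (s : Fin N → ℝ) (μ x : Ω → Joint d) (ω : Ω) : Joint d :=
  fun i => (1 / s i) • (x ω i - μ ω i)

theorem sample_noise (hs : ∀ i, 0 < s i) (ω : Ω) : sample (μ ω) s (noise s μ x ω) = x ω := by
  funext i
  simp only [sample, noise]
  rw [smul_smul, mul_one_div_cancel (hs i).ne', one_smul, add_sub_cancel]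

/-- The normal law with standard deviations `s`, as a kernel in its mean. -/
def normalKernel (s : Fin N → ℝ) : Kernel (Joint d) (Joint d) :=
  (Kernel.id ×ₖ Kernel.const _ (stdLaw d)).map fun p => sample p.1 s p.2

theorem normalKernel_apply (s : Fin N → ℝ) (a : Joint d) :
    normalKernel s a = normalLaw a s := by
  have hm : Measurable fun p : Joint d × Joint d => sample p.1 s p.2 :=
    (continuous_sample s).measurable
  rw [normalKernel, Kernel.map_apply _ hm, Kernel.prod_apply, Kernel.id_apply, Kernel.const_apply,
    Measure.dirac_prod, Measure.map_map hm (by fun_prop), normalLaw_eq_map]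
  rfl

instance (s : Fin N → ℝ) : IsMarkovKernel (normalKernel (d := d) s) := by
  unfold normalKernel
  exact Kernel.IsMarkovKernel.map _ (continuous_sample s).measurable

theorem measurable_noise (hμ : Measurable μ) (hx : Measurable x) :
    Measurable (noise s μ x) := by
  unfold noise
  fun_prop

theorem memLp_score (hz : MeasurePreserving (noise s μ x) P (stdLaw d)) (hμ : Measurable μ)
    {h : Joint d → Joint d → ℝ} (hh : Measurable (Function.uncurry h))
    {Φ : Joint d → ℝ} (hΦ : MemLp Φ 2 (stdLaw d)) (hb : ∀ ω z, |h (μ ω) z| ≤ Φ z) :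
    MemLp (fun ω => h (μ ω) (noise s μ x ω)) 2 P :=
  (hΦ.comp_measurePreserving hz).mono'
    (hh.comp (hμ.prodMk hz.measurable)).aestronglyMeasurable (ae_of_all _ fun ω => hb ω _)

variable [IsProbabilityMeasure P]

/-- The standardised perturbation is standard normal and independent of the past `m`. -/
theorem measure_inter_noise_preimage (hm : m ≤ mΩ) (hs : ∀ i, 0 < s i)
    (hμ : Measurable[m] μ) (hx : Measurable x)
    (hlaw : ∀ S : Set Ω, MeasurableSet[m] S → ∀ B : Set (Joint d), MeasurableSet B →
      P (S ∩ x ⁻¹' B) = ∫⁻ ω in S, normalLaw (μ ω) s B ∂P)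
    {S : Set Ω} (hS : MeasurableSet[m] S) {C : Set (Joint d)} (hC : MeasurableSet C) :
    P (S ∩ noise s μ x ⁻¹' C) = P S * stdLaw d C := by
  have hμ' : Measurable μ := hμ.mono hm le_rfl
  -- The conditional law determines the joint law of mean and state on `S`, first on rectangles.
  -- This permits freezing the mean before standardising.
  have hpair : (P.restrict S).map (fun ω => (μ ω, x ω)) =
      ((P.restrict S).map μ) ⊗ₘ normalKernel s := by
    refine Measure.ext_prod fun {U B} hU hB => ?_
    rw [Measure.compProd_apply_prod hU hB, Measure.map_apply (hμ'.prodMk hx) (hU.prod hB),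
      Measure.restrict_apply ((hμ'.prodMk hx) (hU.prod hB)), Measure.restrict_map hμ' hU,
      lintegral_map (Kernel.measurable_coe _ hB) hμ', Measure.restrict_restrict (hμ' hU)]
    simp_rw [normalKernel_apply]
    rw [← hlaw _ ((hμ hU).inter hS) B hB]
    congr 1
    ext ω
    simp only [Set.mem_inter_iff, Set.mem_preimage, Set.mem_prod]
    tauto
  set T : Joint d × Joint d → Joint d := fun p i => (1 / s i) • (p.2 i - p.1 i) with hT
  have hTm : Measurable T := by
    simp only [hT]; fun_prop
  have hstd : ∀ a : Joint d, normalLaw a s (Prod.mk a ⁻¹' (T ⁻¹' C)) = stdLaw d C := by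
    intro a
    have hsm : Measurable (sample a s) :=
      (continuous_sample s).measurable.comp measurable_prodMk_left
    rw [normalLaw_eq_map, Measure.map_apply hsm (measurable_prodMk_left (hTm hC))]
    congr 1
    ext z
    have : T (a, sample a s z) = z := by
      funext i
      simp only [hT, sample, add_sub_cancel_left]
      rw [smul_smul, one_div_mul_cancel (hs i).ne', one_smul]
    simp [this]
  have h1 : P (S ∩ noise s μ x ⁻¹' C) =
      (P.restrict S).map (fun ω => (μ ω, x ω)) (T ⁻¹' C) := by
    rw [Measure.map_apply (hμ'.prodMk hx) (hTm hC),
      Measure.restrict_apply ((hμ'.prodMk hx) (hTm hC)), Set.inter_comm]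
    rfl
  rw [h1, hpair, Measure.compProd_apply (hTm hC)]
  simp_rw [normalKernel_apply, hstd]
  rw [lintegral_const, Measure.map_apply hμ' MeasurableSet.univ, mul_comm]
  simp

/-- Independence in product form, ready for Fubini. -/
theorem map_prodMk_noise (hm : m ≤ mΩ) (hs : ∀ i, 0 < s i)
    (hμ : Measurable[m] μ) (hx : Measurable x)
    (hlaw : ∀ S : Set Ω, MeasurableSet[m] S → ∀ B : Set (Joint d), MeasurableSet B →
      P (S ∩ x ⁻¹' B) = ∫⁻ ω in S, normalLaw (μ ω) s B ∂P)
    {F : Type*} [MeasurableSpace F] {Y : Ω → F} (hY : Measurable[m] Y) :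
    P.map (fun ω => (Y ω, noise s μ x ω)) = (P.map Y).prod (stdLaw d) := by
  have hY' : Measurable Y := hY.mono hm le_rfl
  have hz : Measurable (noise s μ x) := measurable_noise (hμ.mono hm le_rfl) hx
  have := Measure.isProbabilityMeasure_map (μ := P) hY'.aemeasurable
  refine (Measure.prod_eq fun U C hU hC => ?_).symm
  rw [Measure.map_apply (hY'.prodMk hz) (hU.prod hC), Measure.map_apply hY' hU,
    ← measure_inter_noise_preimage hm hs hμ hx hlaw (hY hU) hC]
  rfl

theorem measurePreserving_noise (hm : m ≤ mΩ) (hs : ∀ i, 0 < s i)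
    (hμ : Measurable[m] μ) (hx : Measurable x)
    (hlaw : ∀ S : Set Ω, MeasurableSet[m] S → ∀ B : Set (Joint d), MeasurableSet B →
      P (S ∩ x ⁻¹' B) = ∫⁻ ω in S, normalLaw (μ ω) s B ∂P) :
    MeasurePreserving (noise s μ x) P (stdLaw d) := by
  refine ⟨measurable_noise (hμ.mono hm le_rfl) hx, Measure.ext fun C hC => ?_⟩
  rw [Measure.map_apply (measurable_noise (hμ.mono hm le_rfl) hx) hC]
  simpa using measure_inter_noise_preimage hm hs hμ hx hlaw MeasurableSet.univ hC

/-- Centring a function of the mean and the standardised perturbation, conditionally on the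
past. -/
def centred (h : Joint d → Joint d → ℝ) (s : Fin N → ℝ) (μ x : Ω → Joint d) (ω : Ω) : ℝ :=
  h (μ ω) (noise s μ x ω) - ∫ z, h (μ ω) z ∂stdLaw d

theorem measurable_centred {h : Joint d → Joint d → ℝ} (hh : Measurable (Function.uncurry h))
    (hμ : Measurable μ) (hx : Measurable x) : Measurable (centred h s μ x) := by
  have h1 : Measurable fun a => ∫ z, h a z ∂stdLaw d :=
    (hh.stronglyMeasurable.integral_prod_right (ν := stdLaw d)).measurable
  exact (hh.comp (hμ.prodMk (measurable_noise hμ hx))).sub (h1.comp hμ)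

theorem abs_integral_score_le {h : Joint d → Joint d → ℝ}
    {Φ : Joint d → ℝ} (hΦ : MemLp Φ 2 (stdLaw d)) (hb : ∀ ω z, |h (μ ω) z| ≤ Φ z) (ω : Ω) :
    |∫ z, h (μ ω) z ∂stdLaw d| ≤ ∫ z, Φ z ∂stdLaw d :=
  norm_integral_le_of_norm_le (f := fun z => h (μ ω) z) (hΦ.integrable one_le_two)
    (ae_of_all _ fun z => hb ω z)

theorem memLp_integral_score (hμ : Measurable μ)
    {h : Joint d → Joint d → ℝ} (hh : Measurable (Function.uncurry h))
    {Φ : Joint d → ℝ} (hΦ : MemLp Φ 2 (stdLaw d)) (hb : ∀ ω z, |h (μ ω) z| ≤ Φ z) :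
    MemLp (fun ω => ∫ z, h (μ ω) z ∂stdLaw d) 2 P := by
  have h1 : Measurable fun a => ∫ z, h a z ∂stdLaw d :=
    (hh.stronglyMeasurable.integral_prod_right (ν := stdLaw d)).measurable
  exact MemLp.of_bound (h1.comp hμ).aestronglyMeasurable _
    (ae_of_all _ fun ω => abs_integral_score_le hΦ hb ω)

theorem memLp_centred (hz : MeasurePreserving (noise s μ x) P (stdLaw d)) (hμ : Measurable μ)
    {h : Joint d → Joint d → ℝ} (hh : Measurable (Function.uncurry h))
    {Φ : Joint d → ℝ} (hΦ : MemLp Φ 2 (stdLaw d)) (hb : ∀ ω z, |h (μ ω) z| ≤ Φ z) :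
    MemLp (centred h s μ x) 2 P :=
  (memLp_score hz hμ hh hΦ hb).sub (memLp_integral_score hμ hh hΦ hb)

/-- From `(u - v) ^ 2 ≤ 2 * u ^ 2 + 2 * v ^ 2`; the bound depends on `Φ` alone, hence is uniform in
time. -/
theorem integral_centred_sq_le (hz : MeasurePreserving (noise s μ x) P (stdLaw d))
    (hμ : Measurable μ) {h : Joint d → Joint d → ℝ} (hh : Measurable (Function.uncurry h))
    {Φ : Joint d → ℝ} (hΦ : MemLp Φ 2 (stdLaw d)) (hb : ∀ ω z, |h (μ ω) z| ≤ Φ z) :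
    ∫ ω, centred h s μ x ω ^ 2 ∂P ≤
      2 * ∫ z, Φ z ^ 2 ∂stdLaw d + 2 * (∫ z, Φ z ∂stdLaw d) ^ 2 := by
  have hint : Integrable (fun ω => 2 * Φ (noise s μ x ω) ^ 2) P :=
    (hΦ.comp_measurePreserving hz).integrable_sq.const_mul 2
  have heq : ∫ ω, Φ (noise s μ x ω) ^ 2 ∂P = ∫ z, Φ z ^ 2 ∂stdLaw d := by
    rw [← hz.map_eq, integral_map hz.measurable.aemeasurable
      (by rw [hz.map_eq]; exact hΦ.integrable_sq.1)]
  calc ∫ ω, centred h s μ x ω ^ 2 ∂P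
      ≤ ∫ ω, (2 * Φ (noise s μ x ω) ^ 2 + 2 * (∫ z, Φ z ∂stdLaw d) ^ 2) ∂P := by
        refine integral_mono (memLp_centred hz hμ hh hΦ hb).integrable_sq
          (hint.add (integrable_const _)) fun ω => ?_
        have h1 := hb ω (noise s μ x ω)
        have h2 := abs_integral_score_le hΦ hb ω
        have h3 := sq_le_sq' (by linarith [neg_abs_le (h (μ ω) (noise s μ x ω))])
          ((le_abs_self _).trans h1)
        have h4 := sq_le_sq' (by linarith [neg_abs_le (∫ z, h (μ ω) z ∂stdLaw d)])
          ((le_abs_self _).trans h2)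
        simp only [centred]
        nlinarith [sq_nonneg (h (μ ω) (noise s μ x ω) + ∫ z, h (μ ω) z ∂stdLaw d)]
    _ = _ := by
        rw [integral_add hint (integrable_const _), integral_const_mul, heq]
        simp

/-- Fubini with the pair `(μ, g)` frozen replaces the score by its mean over `z`. This is the
conditional centring in the form of orthogonality to the past. -/
theorem integral_mul_centred (hm : m ≤ mΩ) (hs : ∀ i, 0 < s i)
    (hμ : Measurable[m] μ) (hx : Measurable x)
    (hlaw : ∀ S : Set Ω, MeasurableSet[m] S → ∀ B : Set (Joint d), MeasurableSet B →
      P (S ∩ x ⁻¹' B) = ∫⁻ ω in S, normalLaw (μ ω) s B ∂P)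
    {h : Joint d → Joint d → ℝ} (hh : Measurable (Function.uncurry h))
    {Φ : Joint d → ℝ} (hΦ : MemLp Φ 2 (stdLaw d)) (hb : ∀ ω z, |h (μ ω) z| ≤ Φ z)
    {g : Ω → ℝ} (hg : Measurable[m] g) (hg2 : MemLp g 2 P) :
    ∫ ω, g ω * centred h s μ x ω ∂P = 0 := by
  have hμ' : Measurable μ := hμ.mono hm le_rfl
  have hg' : Measurable g := hg.mono hm le_rfl
  have hz := measurePreserving_noise hm hs hμ hx hlaw
  have hY : Measurable[m] fun ω => (μ ω, g ω) := hμ.prodMk hg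
  have hY' : Measurable fun ω => (μ ω, g ω) := hμ'.prodMk hg'
  have hmap := map_prodMk_noise hm hs hμ hx hlaw hY
  have hi1 : Integrable (fun ω => g ω * h (μ ω) (noise s μ x ω)) P :=
    hg2.integrable_mul (memLp_score hz hμ' hh hΦ hb)
  have hi2 : Integrable (fun ω => g ω * ∫ z, h (μ ω) z ∂stdLaw d) P :=
    hg2.integrable_mul (memLp_integral_score hμ' hh hΦ hb)
  set F : (Joint d × ℝ) × Joint d → ℝ := fun p => p.1.2 * h p.1.1 p.2 with hF
  have hFm : Measurable F := by
    refine (measurable_snd.comp measurable_fst).mul ?_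
    exact hh.comp ((measurable_fst.comp measurable_fst).prodMk measurable_snd)
  have hpair : Measurable fun ω => ((μ ω, g ω), noise s μ x ω) := hY'.prodMk hz.measurable
  have hFi : Integrable F ((P.map fun ω => (μ ω, g ω)).prod (stdLaw d)) := by
    rw [← hmap, integrable_map_measure hFm.aestronglyMeasurable hpair.aemeasurable]
    exact hi1
  have := Measure.isProbabilityMeasure_map (μ := P) hY'.aemeasurable
  have hmain : ∫ ω, g ω * h (μ ω) (noise s μ x ω) ∂P =
      ∫ ω, g ω * ∫ z, h (μ ω) z ∂stdLaw d ∂P := by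
    calc ∫ ω, g ω * h (μ ω) (noise s μ x ω) ∂P
        = ∫ p, F p ∂(P.map fun ω => ((μ ω, g ω), noise s μ x ω)) := by
          rw [integral_map hpair.aemeasurable hFm.aestronglyMeasurable]
      _ = ∫ y, ∫ z, F (y, z) ∂stdLaw d ∂(P.map fun ω => (μ ω, g ω)) := by
          rw [hmap, integral_prod _ hFi]
      _ = ∫ ω, ∫ z, F ((μ ω, g ω), z) ∂stdLaw d ∂P := by
          rw [integral_map hY'.aemeasurable]
          exact (hFm.stronglyMeasurable.integral_prod_right
            (ν := stdLaw d)).aestronglyMeasurable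
      _ = _ := by
          simp only [hF, integral_const_mul]
  simp only [centred, mul_sub]
  rw [integral_sub hi1 hi2, hmain, sub_self]

end Noise

/-! ### Consequences of the step size conditions -/

section Steps

variable {γ σ : Fin N → ℕ → ℝ}

theorem iInf_beta_le (i : Fin N) (t : ℕ) : ⨅ j, beta γ σ j t ≤ beta γ σ i t :=
  ciInf_le (Set.finite_range _).bddBelow i

theorem beta_le_iSup (i : Fin N) (t : ℕ) : beta γ σ i t ≤ ⨆ j, beta γ σ j t :=
  le_ciSup (f := fun j => beta γ σ j t) (Set.finite_range _).bddAbove i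

theorem StepSizes.beta_pos (h : StepSizes γ σ) (i : Fin N) (t : ℕ) : 0 < beta γ σ i t :=
  mul_pos (h.step_pos i t) (pow_pos (h.sd_pos i t) 2)

theorem StepSizes.iInf_beta_nonneg (h : StepSizes γ σ) (t : ℕ) : 0 ≤ ⨅ j, beta γ σ j t :=
  Real.iInf_nonneg fun i => (h.beta_pos i t).le

/-- Without players the real infimum is `0` by convention, and its sums cannot diverge. -/
theorem StepSizes.nonempty (h : StepSizes γ σ) : Nonempty (Fin N) := by
  by_contra hne
  rw [not_nonempty_iff] at hne
  have := h.sum_min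
  simp only [Real.iInf_of_isEmpty, Finset.sum_const_zero] at this
  exact not_tendsto_const_atTop _ _ this

theorem StepSizes.sq_le (h : StepSizes γ σ) (i : Fin N) (t : ℕ) :
    (γ i t * σ i t) ^ 2 ≤ (⨆ j, γ j t) ^ 2 * (⨆ j, σ j t) ^ 2 := by
  rw [mul_pow]
  have h1 : γ i t ≤ ⨆ j, γ j t := le_ciSup (f := fun j => γ j t) (Set.finite_range _).bddAbove i
  have h2 : σ i t ≤ ⨆ j, σ j t := le_ciSup (f := fun j => σ j t) (Set.finite_range _).bddAbove i
  have := (h.step_pos i t).le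
  have := (h.sd_pos i t).le
  gcongr

theorem StepSizes.summable_sq (h : StepSizes γ σ) (i : Fin N) :
    Summable fun t => (γ i t * σ i t) ^ 2 :=
  Summable.of_nonneg_of_le (fun _ => sq_nonneg _) (h.sq_le i) h.sum_sq

/-- The coefficient of the score in the update is square summable. -/
theorem StepSizes.summable_coeff_sq (h : StepSizes γ σ) (i : Fin N)
    (hr : ∃ K : ℝ, ∀ t, σ i (t + 1) ≤ K * σ i t) :
    Summable fun t => (beta γ σ i (t + 1) / σ i t) ^ 2 := by
  obtain ⟨K, hK⟩ := hr
  refine Summable.of_nonneg_of_le (fun _ => sq_nonneg _) (fun t => ?_)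
    (((summable_nat_add_iff 1).2 (h.summable_sq i)).mul_left (K ^ 2))
  rw [← mul_pow]
  have h1 := h.sd_pos i t
  have h2 := h.sd_pos i (t + 1)
  have h3 := h.step_pos i (t + 1)
  refine pow_le_pow_left₀ (div_nonneg (h.beta_pos i _).le h1.le) ?_ 2
  rw [div_le_iff₀ h1, beta]
  -- One factor `σ i (t + 1)` is traded for `K * σ i t`, which cancels the denominator and leaves
  -- the square summable `γ i (t + 1) * σ i (t + 1)`.
  calc γ i (t + 1) * σ i (t + 1) ^ 2 = γ i (t + 1) * σ i (t + 1) * σ i (t + 1) := by ring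
    _ ≤ γ i (t + 1) * σ i (t + 1) * (K * σ i t) := by
        gcongr
        exact hK t
    _ = _ := by ring

theorem StepSizes.exists_iInf_beta_le (h : StepSizes γ σ)
    (hσ : ∀ i, Tendsto (σ i) atTop (𝓝 0)) : ∃ B, ∀ t, ⨅ j, beta γ σ j t ≤ B := by
  obtain ⟨i⟩ := h.nonempty
  have h1 : Tendsto (fun t => (γ i t * σ i t) ^ 2 * σ i t ^ 2) atTop (𝓝 (0 * 0 ^ 2)) :=
    (h.summable_sq i).tendsto_atTop_zero.mul ((hσ i).pow 2)
  obtain ⟨B, hB⟩ := h1.bddAbove_range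
  refine ⟨1 + B, fun t => (iInf_beta_le i t).trans ?_⟩
  have h2 : (γ i t * σ i t) ^ 2 * σ i t ^ 2 ≤ B := hB ⟨t, rfl⟩
  have h3 : beta γ σ i t ^ 2 = (γ i t * σ i t) ^ 2 * σ i t ^ 2 := by rw [beta]; ring
  nlinarith [sq_nonneg (beta γ σ i t - 1)]

end Steps

/-! ### One step of the algorithm -/

section Run

variable {A : (i : Fin N) → Set (EuclideanSpace ℝ (Fin (d i)))} {J : Fin N → Joint d → ℝ}
  {γ σ : Fin N → ℕ → ℝ}

/-- The sampled cost of player `i` times the component of its standardised perturbation along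
the deviation of the mean from `a`. -/
def score (J : Fin N → Joint d → ℝ) (a : Joint d) (s : Fin N → ℝ) (i : Fin N) (m z : Joint d) : ℝ :=
  J i (sample m s z) * inner ℝ (m i - a i) (z i)

theorem measurable_score (hJ : ∀ i, ContDiff ℝ 1 (J i)) (a : Joint d) (s : Fin N → ℝ)
    (i : Fin N) : Measurable (Function.uncurry (score J a s i)) := by
  have h1 : Continuous fun p : Joint d × Joint d => J i (sample p.1 s p.2) :=
    (hJ i).continuous.comp (continuous_sample s)
  have h2 : Continuous fun p : Joint d × Joint d => inner ℝ (p.1 i - a i) (p.2 i) := by fun_prop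
  exact (h1.mul h2).measurable

/-- One projected update of player `i`. -/
theorem norm_sq_update_le {i : Fin N} (hcv : Convex ℝ (A i)) {a m x : Joint d}
    {s : Fin N → ℝ} (hs : ∀ j, 0 < s j) (ha : a i ∈ A i) {b : ℝ} {m' z : Joint d}
    (hz : x = sample m s z)
    (hup : IsProj (A i) (m i - b • (J i x • ((1 / s i ^ 2) • (x i - m i)))) (m' i)) :
    ‖m' i - a i‖ ^ 2 ≤ ‖m i - a i‖ ^ 2 - 2 * (b / s i) * score J a s i m z +
      (b / s i) ^ 2 * (|J i (sample m s z)| * ‖z i‖) ^ 2 := by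
  -- The point `a i` is its own projection, so projecting does not increase the distance to it.
  have h1 := hup.norm_sub_le hcv (isProj_self ha)
  have h2 : m i - b • (J i x • ((1 / s i ^ 2) • (x i - m i))) - a i =
      (m i - a i) - ((b / s i) * J i (sample m s z)) • z i := by
    have h3 : x i - m i = s i • z i := by rw [hz]; simp [sample]
    have h4 : b * J i x * (1 / s i ^ 2) * s i = b / s i * J i x := by
      have := (hs i).ne'
      field_simp
    rw [h3, smul_smul, smul_smul, smul_smul, h4, ← hz]
    abel
  rw [h2] at h1
  refine (pow_le_pow_left₀ (norm_nonneg _) h1 2).trans (le_of_eq ?_)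
  rw [norm_sub_sq_real, inner_smul_right, norm_smul, mul_pow, Real.norm_eq_abs, sq_abs, mul_pow,
    mul_pow, sq_abs, score]
  ring

theorem exists_norm_le_of_feasible (hcp : ∀ i, IsCompact (A i)) :
    ∃ R, 0 ≤ R ∧ ∀ m ∈ feasible A, ‖m‖ ≤ R := by
  obtain ⟨R, hR⟩ := (isCompact_feasible hcp).isBounded.exists_norm_le
  exact ⟨max R 0, le_max_right _ _, fun m hm => (hR m hm).trans (le_max_left _ _)⟩

theorem sum_sd_tendsto_zero (hσ : ∀ i, Tendsto (σ i) atTop (𝓝 0)) :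
    Tendsto (fun t => ∑ j, σ j t) atTop (𝓝 0) := by
  simpa using tendsto_finsetSum Finset.univ fun j _ => hσ j

theorem StepSizes.sd_le_sum (h : StepSizes γ σ) (j : Fin N) (t : ℕ) : σ j t ≤ ∑ k, σ k t :=
  Finset.single_le_sum (f := fun k => σ k t) (fun k _ => (h.sd_pos k t).le) (Finset.mem_univ j)

/-- Descent of the squared distance of player `i` to the equilibrium, in terms of the smallest
step `b`, the drift `q`, the bias `r` and centred noise. -/
theorem descent_step {v v' c β b w q r H S X G sd B : ℝ}
    (hup : v' ≤ v - 2 * c * S + c ^ 2 * X ^ 2) (hX : 0 ≤ X) (hXG : X ≤ G) (hc : 0 ≤ c)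
    (hβ : c * sd = β) (hb : b ≤ β) (hw : β - b ≤ w)
    (hH : |H - sd * q| ≤ sd * r) (hq : |q| + r ≤ B) (hB : 0 ≤ B) :
    v' ≤ v - b * (2 * q - 2 * r) + (2 * B * w + c ^ 2 * G ^ 2 - 2 * (c * (S - H))) := by
  have h1 : c ^ 2 * X ^ 2 ≤ c ^ 2 * G ^ 2 := by gcongr
  have h2 : c * (sd * q - sd * r) ≤ c * H :=
    mul_le_mul_of_nonneg_left (by linarith [(abs_le.1 hH).1]) hc
  have h3 : c * (sd * q - sd * r) = β * (q - r) := by rw [← hβ]; ring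
  -- The drift `q` of a single player may be negative, so replacing `β` by the smaller `b` is not
  -- free: it costs up to `w * B`.
  have h4 : -B ≤ q - r := by linarith [neg_abs_le q]
  have h5 : (β - b) * -B ≤ (β - b) * (q - r) := mul_le_mul_of_nonneg_left h4 (by linarith)
  have h7 : (β - b) * B ≤ w * B := mul_le_mul_of_nonneg_right hw hB
  nlinarith

end Run

/-! ### Almost sure convergence of the means, convergence in probability of the states -/

section Convergence

variable {A : (i : Fin N) → Set (EuclideanSpace ℝ (Fin (d i)))} {J : Fin N → Joint d → ℝ}
  {γ σ : Fin N → ℕ → ℝ}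
  {Ω : Type*} {mΩ : MeasurableSpace Ω} {P : Measure Ω}
  {ℱ : Filtration ℕ mΩ} {μ x : ℕ → Ω → Joint d}

theorem IsRun.mean_mem (hrun : IsRun P ℱ A J γ σ μ x) (t : ℕ) (ω : Ω) :
    μ (t + 1) ω ∈ feasible A := fun i => (hrun.update t ω i).1

variable [IsProbabilityMeasure P]

theorem IsRun.measurePreserving_noise (hrun : IsRun P ℱ A J γ σ μ x)
    (hσ : ∀ i t, 0 < σ i t) (t : ℕ) :
    MeasurePreserving (noise (fun i => σ i t) (μ t) (x t)) P (stdLaw d) :=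
  PayoffLearning.measurePreserving_noise (ℱ.le t) (fun i => hσ i t) (hrun.mean_meas t)
    ((hrun.state_meas t).mono (ℱ.le _) le_rfl) (hrun.state_law t)

/-- The filtration started at time one. -/
def shiftFiltration (ℱ : Filtration ℕ mΩ) : Filtration ℕ mΩ where
  seq t := ℱ (t + 1)
  mono' _ _ h := ℱ.mono (Nat.add_le_add_right h 1)
  le' _ := ℱ.le _

/-- The centred scores, weighted with the steps, have an almost surely convergent sum. -/
theorem IsRun.ae_tendsto_sum_centred (hrun : IsRun P ℱ A J γ σ μ x)
    (hσ : ∀ i t, 0 < σ i t) {h : ℕ → Joint d → Joint d → ℝ}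
    (hh : ∀ t, Measurable (Function.uncurry (h t))) {Φ : Joint d → ℝ}
    (hΦ : MemLp Φ 2 (stdLaw d)) (hb : ∀ t, ∀ m ∈ feasible A, ∀ z, |h t m z| ≤ Φ z)
    {c : ℕ → ℝ} (hc : Summable fun t => c t ^ 2) :
    ∀ᵐ ω ∂P, ∃ l, Tendsto (fun n => ∑ t ∈ Finset.range n,
      c t * centred (h t) (fun j => σ j (t + 1)) (μ (t + 1)) (x (t + 1)) ω) atTop (𝓝 l) := by
  have hz := fun t => hrun.measurePreserving_noise hσ (t + 1)
  have hμ : ∀ t, Measurable (μ (t + 1)) := fun t =>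
    (hrun.mean_meas (t + 1)).mono (ℱ.le _) le_rfl
  have hb' : ∀ t ω z, |h t (μ (t + 1) ω) z| ≤ Φ z := fun t ω z =>
    hb t _ (hrun.mean_mem t ω) z
  -- Time starts at one because `μ 0` need not be feasible, and the domination by `Φ` is uniform
  -- only over feasible means.
  refine ae_tendsto_sum_of_orthogonal (ℱ := shiftFiltration ℱ) (fun t => ?_) (fun t => ?_)
    (fun t g hg hg2 => ?_) ?_
  · refine Measurable.stronglyMeasurable (Measurable.const_mul ?_ _)
    exact measurable_centred (hh t)
      ((hrun.mean_meas (t + 1)).mono (ℱ.mono (Nat.le_succ _)) le_rfl) (hrun.state_meas (t + 1))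
  · exact (memLp_centred (hz t) (hμ t) (hh t) hΦ (hb' t)).const_mul _
  · have h0 := integral_mul_centred (ℱ.le (t + 1)) (fun i => hσ i (t + 1))
      (hrun.mean_meas (t + 1)) ((hrun.state_meas (t + 1)).mono (ℱ.le _) le_rfl)
      (hrun.state_law (t + 1)) (hh t) hΦ (hb' t) hg.measurable hg2
    simp_rw [mul_left_comm (g _) (c t)]
    rw [integral_const_mul, h0, mul_zero]
  · refine Summable.of_nonneg_of_le (fun t => integral_nonneg fun ω => sq_nonneg _) (fun t => ?_)
      (hc.mul_right (2 * ∫ z, Φ z ^ 2 ∂stdLaw d + 2 * (∫ z, Φ z ∂stdLaw d) ^ 2))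
    simp_rw [mul_pow]
    rw [integral_const_mul]
    exact mul_le_mul_of_nonneg_left
      (integral_centred_sq_le (hz t) (hμ t) (hh t) hΦ (hb' t)) (sq_nonneg _)

/-- All perturbations share one law, so the expectations are a fixed multiple of `c t ^ 2`. This
handles the quadratic terms of the updates. -/
theorem IsRun.ae_summable_sq (hrun : IsRun P ℱ A J γ σ μ x)
    (hσ : ∀ i t, 0 < σ i t) {Φ : Joint d → ℝ} (hΦ : MemLp Φ 2 (stdLaw d))
    {c : ℕ → ℝ} (hc : Summable fun t => c t ^ 2) :
    ∀ᵐ ω ∂P, Summable fun t =>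
      c t ^ 2 * Φ (noise (fun j => σ j (t + 1)) (μ (t + 1)) (x (t + 1)) ω) ^ 2 := by
  have hz := fun t => hrun.measurePreserving_noise hσ (t + 1)
  refine ae_summable_of_summable_integral (fun t ω => by positivity)
    (fun t => (hΦ.comp_measurePreserving (hz t)).integrable_sq.const_mul _) ?_
  refine (hc.mul_right (∫ z, Φ z ^ 2 ∂stdLaw d)).congr fun t => ?_
  rw [integral_const_mul]
  congr 1
  rw [← (hz t).map_eq, integral_map (hz t).measurable.aemeasurable
    (by rw [(hz t).map_eq]; exact hΦ.integrable_sq.1)]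

/-- Almost sure convergence of the means to the solution of the variational inequality. -/
theorem IsRun.ae_tendsto_mean (hrun : IsRun P ℱ A J γ σ μ x)
    (hcv : ∀ i, Convex ℝ (A i)) (hcp : ∀ i, IsCompact (A i)) (hJ : ∀ i, ContDiff ℝ 1 (J i))
    (hmono : StrictlyMonotoneOn (gameMap J) (feasible A))
    (hlip : ∀ i, ∃ L : ℝ≥0, LipschitzWith L fun a => gameMap J a i)
    (hg : ∀ i, GrowsQuadratically J i) (hstep : StepSizes γ σ)
    (hσ : ∀ i, Tendsto (σ i) atTop (𝓝 0)) (hr : ∀ i, ∃ K : ℝ, ∀ t, σ i (t + 1) ≤ K * σ i t)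
    {a : Joint d} (ha : IsVariational A J a) :
    ∀ᵐ ω ∂P, Tendsto (fun t => μ t ω) atTop (𝓝 a) := by
  obtain ⟨R, hR0, hR⟩ := exists_norm_le_of_feasible hcp
  have hcont : Continuous (gameMap J) :=
    (exists_lipschitzWith_gameMap hlip).choose_spec.continuous
  obtain ⟨G, hG⟩ := ((isCompact_feasible hcp).image hcont).isBounded.exists_norm_le
  have hsd := sum_sd_tendsto_zero hσ
  obtain ⟨S₀, hS₀⟩ := hsd.bddAbove_range
  have hSum : ∀ t, ∑ j, σ j t ≤ S₀ := fun t => hS₀ ⟨t, rfl⟩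
  have hsd_nonneg : ∀ t, 0 ≤ ∑ j, σ j t := fun t =>
    Finset.sum_nonneg fun j _ => (hstep.sd_pos j t).le
  have hS0 : 0 ≤ S₀ := (hsd_nonneg 0).trans (hSum 0)
  have hsdS : ∀ t j, |σ j t| ≤ S₀ := fun t j => by
    rw [abs_of_pos (hstep.sd_pos j t)]
    exact (hstep.sd_le_sum j t).trans (hSum t)
  choose Φ hΦ hΦb using fun i => exists_score_bound hJ hlip hg i hR0 hS0
  choose L hL using hlip
  have hdist : ∀ m ∈ feasible A, ∀ i, ‖m i - a i‖ ≤ 2 * R := fun m hm i => by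
    have h1 := (norm_le_pi_norm m i).trans (hR m hm)
    have h2 := (norm_le_pi_norm a i).trans (hR a ha.1)
    exact (norm_sub_le _ _).trans (by linarith)
  have hscore : ∀ i t, ∀ m ∈ feasible A, ∀ z,
      |score J a (fun j => σ j (t + 1)) i m z| ≤ 2 * R * Φ i z := by
    intro i t m hm z
    have h1 := hΦb i m (hR m hm) (fun j => σ j (t + 1)) (hsdS (t + 1)) z
    rw [score, abs_mul]
    calc |J i (sample m _ z)| * |inner ℝ (m i - a i) (z i)|
        ≤ |J i (sample m _ z)| * (2 * R * ‖z i‖) := by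
          gcongr
          exact (abs_real_inner_le_norm _ _).trans (by gcongr; exact hdist m hm i)
      _ = 2 * R * (|J i (sample m (fun j => σ j (t + 1)) z)| * ‖z i‖) := by ring
      _ ≤ _ := by gcongr
  have hΦ' : ∀ i, MemLp (fun z => 2 * R * Φ i z) 2 (stdLaw d) := fun i => (hΦ i).const_mul _
  have hc : ∀ i, Summable fun t => (beta γ σ i (t + 2) / σ i (t + 1)) ^ 2 := fun i =>
    (summable_nat_add_iff 1).2 (hstep.summable_coeff_sq i (hr i))
  have hconv := ae_all_iff.2 fun i => hrun.ae_tendsto_sum_centred hstep.sd_pos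
    (h := fun t => score J a (fun j => σ j (t + 1)) i)
    (fun t => measurable_score hJ a _ i) (hΦ' i) (hscore i) (hc i)
  have hsq := ae_all_iff.2 fun i => hrun.ae_summable_sq hstep.sd_pos (hΦ i) (hc i)
  obtain ⟨B₀, hB₀⟩ := hstep.exists_iInf_beta_le hσ
  -- From here on the path is fixed and the argument is deterministic.
  filter_upwards [hconv, hsq] with ω hω hω2
  choose l hl using hω
  set E3 : ℝ := ∫ z, ‖z‖ ^ 3 ∂stdLaw d with hE3
  have hE30 : 0 ≤ E3 := integral_nonneg fun z => by positivity
  set q : Fin N → ℕ → ℝ := fun i t =>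
    inner ℝ (gameMap J (μ (t + 1) ω) i) (μ (t + 1) ω i - a i) with hq
  set r : Fin N → ℕ → ℝ := fun i t => L i * (∑ j, σ j (t + 1)) * (2 * R) * E3 with hr'
  set B : Fin N → ℝ := fun i => G * (2 * R) + L i * S₀ * (2 * R) * E3 with hB
  have hG0 : 0 ≤ G := (norm_nonneg _).trans (hG _ ⟨a, ha.1, rfl⟩)
  -- Three convergent contributions: unequal steps, the quadratic term and the centred noise. The
  -- update from `μ (t + 1)` to `μ (t + 2)` uses `β` at `t + 2` and `σ` at `t + 1`.
  set n : Fin N → ℕ → ℝ := fun i t =>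
    2 * B i * ((⨆ j, beta γ σ j (t + 2)) - ⨅ j, beta γ σ j (t + 2)) +
      (beta γ σ i (t + 2) / σ i (t + 1)) ^ 2 *
        Φ i (noise (fun j => σ j (t + 1)) (μ (t + 1)) (x (t + 1)) ω) ^ 2 -
      2 * (beta γ σ i (t + 2) / σ i (t + 1) *
        centred (score J a (fun j => σ j (t + 1)) i) (fun j => σ j (t + 1)) (μ (t + 1))
          (x (t + 1)) ω) with hn
  have hplayer : ∀ i t, ‖μ (t + 2) ω i - a i‖ ^ 2 ≤ ‖μ (t + 1) ω i - a i‖ ^ 2 -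
      (⨅ j, beta γ σ j (t + 2)) * (2 * q i t - 2 * r i t) + n i t := by
    intro i t
    have hpos := hstep.sd_pos i (t + 1)
    have hm := hrun.mean_mem t ω
    have hup := norm_sq_update_le (J := J) (hcv i) (fun j => hstep.sd_pos j (t + 1)) (ha.1 i)
      (sample_noise (fun j => hstep.sd_pos j (t + 1)) ω).symm (hrun.update (t + 1) ω i)
    refine descent_step hup (by positivity) (hΦb i _ (hR _ hm) _ (hsdS (t + 1)) _)
      (div_nonneg (hstep.beta_pos i _).le hpos.le) (div_mul_cancel₀ _ hpos.ne')
      (iInf_beta_le i _) (sub_le_sub_right (beta_le_iSup i _) _) ?_ ?_ (by positivity)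
    · have h1 := abs_integral_score_sub_le hJ (hL i) (m := μ (t + 1) ω)
        (s := fun j => σ j (t + 1)) (fun j => (hstep.sd_pos j (t + 1)).le)
        (fun j => hstep.sd_le_sum j (t + 1)) (μ (t + 1) ω i - a i) ?_
      · refine h1.trans ?_
        have h2 := hdist _ hm i
        have h3 := hsd_nonneg (t + 1)
        calc _ ≤ L i * (∑ j, σ j (t + 1)) * σ i (t + 1) * (2 * R) * E3 := by gcongr
          _ = _ := by simp only [hr']; ring
      · have hmeas : Measurable (score J a (fun j => σ j (t + 1)) i (μ (t + 1) ω)) :=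
          (measurable_score hJ a (fun j => σ j (t + 1)) i).comp measurable_prodMk_left
        exact ((hΦ' i).integrable one_le_two).mono' hmeas.aestronglyMeasurable
          (ae_of_all _ fun z => hscore i t _ hm z)
    · refine add_le_add ?_ ?_
      · refine (abs_real_inner_le_norm _ _).trans ?_
        refine mul_le_mul ((norm_le_pi_norm _ i).trans (hG _ ⟨_, hm, rfl⟩)) (hdist _ hm i)
          (norm_nonneg _) hG0
      · simp only [hr']
        gcongr
        exact hSum (t + 1)
  -- Only the sum over the players has a drift of definite sign, which is why a common step `⨅ j, β
  -- j` was extracted for each player.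
  have hV : Tendsto (fun t => ∑ i, ‖μ (t + 1) ω i - a i‖ ^ 2) atTop (𝓝 0) := by
    refine tendsto_zero_of_perturbed_descent (b := fun t => ⨅ j, beta γ σ j (t + 2))
      (φ := fun t => ∑ i, 2 * q i t) (e := fun t => ∑ i, 2 * r i t) (n := fun t => ∑ i, n i t)
      (l := ∑ i, (2 * B i * (∑' t, ((⨆ j, beta γ σ j (t + 2)) - ⨅ j, beta γ σ j (t + 2))) +
        ∑' t, (beta γ σ i (t + 2) / σ i (t + 1)) ^ 2 *
        Φ i (noise (fun j => σ j (t + 1)) (μ (t + 1)) (x (t + 1)) ω) ^ 2 - 2 * l i))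
      (B := B₀) (fun t => by positivity) (fun t => hstep.iInf_beta_nonneg _) (fun t => hB₀ _)
      ?_ ?_ ?_ ?_ ?_ ?_
    · have h1 := (tendsto_add_atTop_iff_nat 2).2 hstep.sum_min
      refine (tendsto_atTop_add_const_right _
        (-∑ t ∈ Finset.range 2, ⨅ j, beta γ σ j t) h1).congr fun k => ?_
      rw [add_comm k 2, Finset.sum_range_add]
      simp only [add_comm 2]
      ring
    · have h1 : ∀ i, Tendsto (fun t => 2 * r i t) atTop (𝓝 0) := fun i => by
        have h2 := ((((tendsto_add_atTop_iff_nat 1).2 hsd).const_mul (L i : ℝ)).mul_const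
          (2 * R)).mul_const E3
        simpa using h2.const_mul 2
      simpa using tendsto_finsetSum Finset.univ fun i _ => h1 i
    · simp_rw [Finset.sum_comm (s := Finset.range _)]
      refine tendsto_finsetSum _ fun i _ => ?_
      have h1 := ((summable_nat_add_iff 2).2 hstep.sum_diff).hasSum.tendsto_sum_nat
      refine (((h1.const_mul (2 * B i)).add (hω2 i).hasSum.tendsto_sum_nat).sub
        ((hl i).const_mul 2)).congr fun k => ?_
      simp only [hn]
      symm
      rw [Finset.sum_sub_distrib, Finset.sum_add_distrib, ← Finset.mul_sum, ← Finset.mul_sum]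
    · intro t
      rw [← Finset.mul_sum]
      refine mul_nonneg zero_le_two ?_
      rcases eq_or_ne (μ (t + 1) ω) a with h | h
      · simp [hq, h]
      · exact (ha.inner_pos hmono (hrun.mean_mem t ω) h).le
    · intro ε hε
      obtain ⟨δ, hδ, hδ'⟩ := ha.exists_drift_bound hcp hmono hcont hε
      refine ⟨δ, hδ, fun t ht => ?_⟩
      have h1 := hδ' _ (hrun.mean_mem t ω) ht
      rw [← Finset.mul_sum]
      simp only [hq]
      linarith
    · intro t
      refine (Finset.sum_le_sum fun i _ => hplayer i t).trans (le_of_eq ?_)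
      rw [Finset.sum_add_distrib, Finset.sum_sub_distrib, ← Finset.mul_sum,
        Finset.sum_sub_distrib]
  refine (tendsto_add_atTop_iff_nat 1).1 (tendsto_pi_nhds.2 fun i => ?_)
  rw [tendsto_iff_norm_sub_tendsto_zero]
  have h1 : Tendsto (fun t => ‖μ (t + 1) ω i - a i‖ ^ 2) atTop (𝓝 0) :=
    squeeze_zero (fun t => sq_nonneg _) (fun t => Finset.single_le_sum
      (f := fun i => ‖μ (t + 1) ω i - a i‖ ^ 2) (fun i _ => sq_nonneg _) (Finset.mem_univ i)) hV
  have h2 := h1.sqrt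
  simpa using h2

theorem eLpNorm_eq_of_measurePreserving {Ω E : Type*} {mΩ : MeasurableSpace Ω} {P : Measure Ω}
    [NormedAddCommGroup E] [MeasurableSpace E] [BorelSpace E] [SecondCountableTopology E]
    {ν : Measure E} {f : Ω → E} (hf : MeasurePreserving f P ν) (p : ℝ≥0∞) :
    eLpNorm f p P = eLpNorm (fun z => z) p ν :=
  eLpNorm_comp_measurePreserving (g := fun z => z) aestronglyMeasurable_id hf

/-- The states converge in probability as soon as the means converge almost surely. -/
theorem IsRun.tendstoInMeasure_state (hrun : IsRun P ℱ A J γ σ μ x)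
    (hpos : ∀ i t, 0 < σ i t) (hσ : ∀ i, Tendsto (σ i) atTop (𝓝 0)) {a : Joint d}
    (hμ : ∀ᵐ ω ∂P, Tendsto (fun t => μ t ω) atTop (𝓝 a)) :
    TendstoInMeasure P x atTop fun _ => a := by
  have hμm : ∀ t, Measurable (μ t) := fun t => (hrun.mean_meas t).mono (ℱ.le _) le_rfl
  have hxm : ∀ t, Measurable (x t) := fun t => (hrun.state_meas t).mono (ℱ.le _) le_rfl
  have h1 : TendstoInMeasure P μ atTop fun _ => a :=
    tendstoInMeasure_of_tendsto_ae (fun t => (hμm t).aestronglyMeasurable) hμ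
  -- The difference is a rescaled standard normal vector, with L¹ norm at most `∑ j, σ j t` times a
  -- constant.
  have h2 : TendstoInMeasure P (fun t ω => x t ω - μ t ω) atTop fun _ => 0 := by
    refine tendstoInMeasure_of_tendsto_eLpNorm one_ne_zero
      (fun t => ((hxm t).sub (hμm t)).aestronglyMeasurable) aestronglyMeasurable_const ?_
    have hfin : eLpNorm (fun z => z) 1 (stdLaw d) ≠ ∞ :=
      (memLp_stdLaw 1 ENNReal.one_ne_top).eLpNorm_ne_top
    have hlim : Tendsto (fun t => ENNReal.ofReal (∑ j, σ j t) * eLpNorm (fun z => z) 1 (stdLaw d))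
        atTop (𝓝 0) := by
      have := ENNReal.Tendsto.mul_const (ENNReal.tendsto_ofReal (sum_sd_tendsto_zero hσ))
        (Or.inr hfin)
      simpa using this
    refine tendsto_of_tendsto_of_tendsto_of_le_of_le tendsto_const_nhds hlim (fun _ => zero_le)
      fun t => ?_
    have hz := hrun.measurePreserving_noise hpos t
    have hz1 : eLpNorm (noise (fun i => σ i t) (μ t) (x t)) 1 P =
        eLpNorm (fun z => z) 1 (stdLaw d) :=
      eLpNorm_eq_of_measurePreserving hz 1
    rw [← hz1]
    refine eLpNorm_le_mul_eLpNorm_of_ae_le_mul (ae_of_all _ fun ω => ?_) 1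
    have hS : 0 ≤ ∑ j, σ j t := Finset.sum_nonneg fun j _ => (hpos j t).le
    have h3 := norm_sample_le (m := (0 : Joint d)) (s := fun i => σ i t) (R := 0) (by simp) hS
      (fun j => by
        rw [abs_of_pos (hpos j t)]
        exact Finset.single_le_sum (f := fun k => σ k t) (fun k _ => (hpos k t).le)
          (Finset.mem_univ j)) (noise (fun i => σ i t) (μ t) (x t) ω)
    have h4 : sample 0 (fun i => σ i t) (noise (fun i => σ i t) (μ t) (x t) ω) =
        x t ω - μ t ω := by
      have h5 := sample_noise (μ := μ t) (x := x t) (fun i => hpos i t) ω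
      refine eq_sub_of_add_eq (Eq.trans ?_ h5)
      funext i
      simp [sample, add_comm]
    rw [h4, zero_add] at h3
    simpa using h3
  rw [tendstoInMeasure_iff_norm] at h1 h2 ⊢
  intro ε hε
  have h3 := (h1 (ε / 2) (by positivity)).add (h2 (ε / 2) (by positivity))
  rw [add_zero] at h3
  refine tendsto_of_tendsto_of_tendsto_of_le_of_le tendsto_const_nhds h3 (fun _ => zero_le)
    fun t => (measure_mono ?_).trans (measure_union_le _ _)
  intro ω hω
  simp only [Set.mem_ofPred_eq, Set.mem_union, sub_zero] at hω ⊢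
  by_contra! hcon
  have h4 := norm_add_le (μ t ω - a) (x t ω - μ t ω)
  have h5 : μ t ω - a + (x t ω - μ t ω) = x t ω - a := by abel
  rw [h5] at h4
  linarith [hcon.1, hcon.2]

end Convergence

end PayoffLearning

end

/-! ### The main theorem -/

theorem theorem2 {N : ℕ} {d : Fin N → ℕ}
    -- a game with local constraints only
    (A : (i : Fin N) → Set (EuclideanSpace ℝ (Fin (d i)))) (J : Fin N → Joint d → ℝ)
    (hA_ne : ∀ i, (A i).Nonempty) (hA_convex : ∀ i, Convex ℝ (A i))
    (hA_compact : ∀ i, IsCompact (A i))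
    (hJ : ∀ i, ContDiff ℝ 1 (J i))
    (hM_mono : StrictlyMonotoneOn (gameMap J) (feasible A))
    (hM_lip : ∀ i, ∃ L : ℝ≥0, LipschitzWith L fun a => gameMap J a i)
    (hJ_growth : ∀ i, GrowsQuadratically J i)
    -- step sizes and standard deviations
    (γ σ : Fin N → ℕ → ℝ) (hstep : StepSizes γ σ)
    (hσ_zero : ∀ i, Tendsto (σ i) atTop (𝓝 0))
    (hσ_ratio : ∀ i, ∃ K : ℝ, ∀ t, σ i (t + 1) ≤ K * σ i t)
    -- a run of the algorithm
    {Ω : Type*} {mΩ : MeasurableSpace Ω} (P : Measure Ω) [IsProbabilityMeasure P]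
    (ℱ : Filtration ℕ mΩ) (μ x : ℕ → Ω → Joint d) (hrun : IsRun P ℱ A J γ σ μ x) :
    ∃ a : Joint d, IsNash A J a ∧ (∀ b, IsNash A J b → b = a) ∧
      (∀ᵐ ω ∂P, Tendsto (fun t => μ t ω) atTop (𝓝 a)) ∧
      TendstoInMeasure P x atTop (fun _ => a) := by
  obtain ⟨a, ha⟩ := exists_isVariational hA_ne hA_convex hA_compact hM_mono hM_lip
  have hconv := hrun.ae_tendsto_mean hA_convex hA_compact hJ hM_mono hM_lip hJ_growth hstep
    hσ_zero hσ_ratio ha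
  exact ⟨a, ha.isNash hJ hA_convex hM_mono,
    fun b hb => ha.unique hM_mono (hb.isVariational hJ hA_convex), hconv,
    hrun.tendstoInMeasure_state hstep.sd_pos hσ_zero hconv⟩
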